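/- Let $n\ge 0$ be an integer. \emph{Definitions.} A fully packed loop configuration (FPL) of size $N$ is a set of edges of the $N\times N$ square grid together with its $4N$ boundary edges (the edges joining the grid to the rest of $\mathbb Z^2$), such that every vertex of the grid has degree exactly $2$ and the boundary edges are, going around the grid, alternatingly in and out of the set, the top edge along the left border being in. The outer ends of the $2N$ boundary edges that are in are labelled $1,\dots,2N$ counterclockwise, starting with the top left one; the coupling of the FPL is the set of pairs $\{i,j\}$ such that the endpoints $i\neq j$ are joined by a path of the FPL. A plane coupling of size $N$ is a noncrossing partition of $\{1,\dots,2N\}$ into pairs. An FPL is half-turn symmetric (an HTFPL) if it is invariant under the central symmetry of the grid. A punctured version of a plane coupling $\pi$ of size $n$ is a plane coupling $\pi'$ of size $2n$ (that is, of $\{1,\dots,4n\}$) which is invariant under $i\mapsto i+2n$ (mod $4n$) and whose pairs, reduced modulo $2n$ to $\{1,\dots,2n\}$, are exactly the pairs of $\pi$. Let $\pi_{0,n}=\{\{i,2n+1-i\}: 1\le i\le n\}$. A plane partition is a finite subset of $\mathbb N^3$ closed under decreasing coordinates; it is cyclically symmetric if it is invariant under $(i,j,k)\mapsto(j,k,i)$.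 \textbf{Theorem.} The punctured versions of $\pi_{0,n}$ are exactly the $n+1$ pairwise distinct couplings $\pi'_{k,n}$, $0\le k\le n$, where $\pi'_{k,n}$ consists of the pairs $\{i,4n+1-i\}$ and $\{2n+i,2n+1-i\}$ for $1\le i\le k$ and of the pairs $\{i,2n+1-i\}$ and $\{2n+i,4n+1-i\}$ for $k<i\le n$. Moreover, there is a bijection between the set of half-turn symmetric FPLs of size $2n$ whose coupling is a punctured version of $\pi_{0,n}$ and the set of cyclically symmetric plane partitions contained in the $n\times n\times n$ box $\{0,\dots,n-1\}^3$. -/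

import Mathlib

namespace FPLoop

/-! ### Fully packed loop configurations -/

/-- The vertices of the `N × N` square grid: the points `(x, y)` with `1 ≤ x, y ≤ N`
(`x` grows to the right and `y` upwards). -/
def grid (N : ℕ) : Set (ℤ × ℤ) :=
  {v | 1 ≤ v.1 ∧ v.1 ≤ N ∧ 1 ≤ v.2 ∧ v.2 ≤ N}

/-- The `4 * N` boundary edges join the grid to the rest of `ℤ²`. They are numbered by
`p = 0, …, 4 * N - 1` counterclockwise, starting with the top edge along the left border: left
border downwards, bottom border rightwards, right border upwards, top border leftwards. This is
the endpoint of the boundary edge number `p` that lies outside the grid. -/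
def outerVertex (N p : ℕ) : ℤ × ℤ :=
  if p < N then (0, (N : ℤ) - p)
  else if p < 2 * N then ((p : ℤ) - N + 1, 0)
  else if p < 3 * N then ((N : ℤ) + 1, (p : ℤ) - 2 * N + 1)
  else (4 * (N : ℤ) - p, (N : ℤ) + 1)

/-- The endpoint of the boundary edge number `p` that lies in the grid. -/
def innerVertex (N p : ℕ) : ℤ × ℤ :=
  if p < N then (1, (N : ℤ) - p)
  else if p < 2 * N then ((p : ℤ) - N + 1, 1)
  else if p < 3 * N then ((N : ℤ), (p : ℤ) - 2 * N + 1)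
  else (4 * (N : ℤ) - p, (N : ℤ))

/-- A fully packed loop configuration of size `N`, given with its boundary edges: a set of edges
of the lattice `ℤ²`, each with at least one end in the `N × N` grid, such that each vertex of the
grid has degree exactly two, and such that the boundary edges are alternatingly in and out, the
top edge along the left border being in. -/
structure FPL (N : ℕ) where
  /-- the chosen edges, as a graph on `ℤ²` -/
  graph : SimpleGraph (ℤ × ℤ)
  lattice : ∀ u v, graph.Adj u v → |u.1 - v.1| + |u.2 - v.2| = 1
  meets_grid : ∀ u v, graph.Adj u v → u ∈ grid N ∨ v ∈ grid N
  degree_eq_two : ∀ v ∈ grid N, (graph.neighborSet v).ncard = 2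
  boundary : ∀ p < 4 * N, (graph.Adj (outerVertex N p) (innerVertex N p) ↔ Even p)

/-- The central symmetry of the `N × N` grid. -/
def halfTurn (N : ℕ) (v : ℤ × ℤ) : ℤ × ℤ :=
  ((N : ℤ) + 1 - v.1, (N : ℤ) + 1 - v.2)

/-- Invariance of a configuration under the central symmetry of the grid. -/
def FPL.IsHalfTurnSymmetric {N : ℕ} (f : FPL N) : Prop :=
  ∀ u v, f.graph.Adj (halfTurn N u) (halfTurn N v) ↔ f.graph.Adj u v

/-- The `2 * N` endpoints of the open paths are the outer ends of the boundary edges that are in,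
labelled `1, …, 2 * N` counterclockwise from the top left one. This is the endpoint with
label `i`, for `1 ≤ i ≤ 2 * N`. -/
def endpoint (N i : ℕ) : ℤ × ℤ := outerVertex N (2 * (i - 1))

/-- The coupling of a configuration: the set of all pairs `{i, j}` of distinct labels in
`{1, …, 2 * N}` such that a path of the configuration joins the endpoints `i` and `j`. -/
def FPL.coupling {N : ℕ} (f : FPL N) : Set (Sym2 ℕ) :=
  {e | ∃ i j : ℕ, 1 ≤ i ∧ i < j ∧ j ≤ 2 * N ∧ e = s(i, j) ∧
    f.graph.Reachable (endpoint N i) (endpoint N j)}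

/-! ### Plane couplings, half-turn symmetric (punctured) couplings and their projection -/

/-- A plane coupling of size `N`: a partition of `{1, …, 2 * N}` into pairs, without crossings. -/
structure IsCoupling (N : ℕ) (c : Set (Sym2 ℕ)) : Prop where
  mem_range : ∀ e ∈ c, ∀ i ∈ e, 1 ≤ i ∧ i ≤ 2 * N
  not_isDiag : ∀ e ∈ c, ¬ e.IsDiag
  existsUnique_mem : ∀ i, 1 ≤ i → i ≤ 2 * N → ∃! e, e ∈ c ∧ i ∈ e
  noncrossing : ∀ i k j l, i < k → k < j → j < l → s(i, j) ∈ c → s(k, l) ∉ c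

/-- The half-turn `i ↦ i + L` (modulo `2 * L`) of the labels `1, …, 2 * L`. -/
def labelHalfTurn (L i : ℕ) : ℕ := if i ≤ L then i + L else i - L

/-- The reduction modulo `L` of the labels `1, …, 2 * L` to the labels `1, …, L`. -/
def labelFold (L i : ℕ) : ℕ := if i ≤ L then i else i - L

/-- Half-turn symmetric plane couplings of size `L`. For even `L` these are the same as the plane
couplings of the `L` points `1, …, L` drawn on a punctured disk. -/
def IsHalfTurnCoupling (L : ℕ) (c : Set (Sym2 ℕ)) : Prop :=
  IsCoupling L c ∧ Sym2.map (labelHalfTurn L) '' c = c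

/-- Forgetting the puncture: the pairs `{j, k}` and `{j + L, k + L}` become one pair `{j, k}` of
points of `{1, …, L}`. -/
def forgetPuncture (L : ℕ) (c : Set (Sym2 ℕ)) : Set (Sym2 ℕ) := Sym2.map (labelFold L) '' c

/-- `c` is a punctured version of the coupling `d` of size `n` (on the points `1, …, 2 * n`):
a half-turn symmetric plane coupling of size `2 * n` (on the points `1, …, 4 * n`) that projects
to `d` when the puncture is forgotten. -/
def IsPuncturedVersion (n : ℕ) (d c : Set (Sym2 ℕ)) : Prop :=
  IsHalfTurnCoupling (2 * n) c ∧ forgetPuncture (2 * n) c = d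

/-- The coupling `π_{0,n}`, whose pairs are the `{i, 2n+1-i}` for `1 ≤ i ≤ n`. -/
def rarestCoupling (n : ℕ) : Set (Sym2 ℕ) :=
  {e | ∃ i, 1 ≤ i ∧ i ≤ n ∧ e = s(i, 2 * n + 1 - i)}

/-- The coupling `π'_{k,n}` on the points `1, …, 4 * n`: the pairs `{i, 4n+1-i}` for
`1 ≤ i ≤ k` and `{i, 2n+1-i}` for `k < i ≤ n`, and their images under the half-turn. -/
def puncturedRarest (k n : ℕ) : Set (Sym2 ℕ) :=
  {e | ∃ i, 1 ≤ i ∧ i ≤ k ∧ (e = s(i, 4 * n + 1 - i) ∨ e = s(2 * n + i, 2 * n + 1 - i))} ∪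
  {e | ∃ i, k < i ∧ i ≤ n ∧ (e = s(i, 2 * n + 1 - i) ∨ e = s(2 * n + i, 4 * n + 1 - i))}

/-! ### Plane partitions -/

/-- A plane partition, as its three-dimensional diagram: a finite set of cells of `ℕ³` that is
closed under decreasing coordinates. -/
structure PlanePartition where
  cells : Finset (ℕ × ℕ × ℕ)
  isLowerSet : IsLowerSet (cells : Set (ℕ × ℕ × ℕ))

/-- The diagram lies in the `m × m × m` box. -/
def PlanePartition.FitsInBox (P : PlanePartition) (m : ℕ) : Prop :=
  ∀ i j k, (i, j, k) ∈ P.cells → i < m ∧ j < m ∧ k < m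

/-- The diagram is invariant under the cyclic permutation of the coordinates. -/
def PlanePartition.IsCyclicallySymmetric (P : PlanePartition) : Prop :=
  ∀ i j k, (i, j, k) ∈ P.cells ↔ (j, k, i) ∈ P.cells

end FPLoop

namespace FPLoop

/-! Punctured versions. A pair of `rarestCoupling n` joins a label of `{1, …, n}` to one of `{n+1,
…, 2n}`. In a punctured version, `i ≤ n` is therefore paired either with `2n+1-i` (short) or with
`4n+1-i` (long). If `i'` is long and `i < i'`, a short `i` would cross it, so the long labels are
exactly `1, …, k` for some `k`; half-turn invariance fixes the rest.

Configurations as functions. An FPL of even size is the same as a corner-sum function `C` on the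
faces of the grid: crossing an edge changes `C` by 0 or 1, and the parity of the edge decides which
of the two means that it is present. Degree two at a vertex says exactly that the increments around
it sum to zero (`FPL.jump_vertex`).

Frozen triangles. The labels `1, …, n` sit on the left side and `n+1, …, 2n` on the bottom, so in a
punctured version no path joins two endpoints of one side. By induction on the column, this forces
every second horizontal edge of the left triangle (`isFrozen_of_not_reachable`) and, by
transposition, every second vertical edge of the bottom triangle. Conversely, frozen edges push all
paths towards the sides. An invariant of the paths (`pathClass`) then takes each of its values at
exactly two endpoints, which form a pair of `puncturedRarest k n` with `k = n - C n n`. So the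
coupling is a punctured version if and only if the triangles are frozen.

Plane partitions. `C` is constant across frozen edges, hence on the lower half it is a function `h a
b`, with `b < a` for the left triangle and `a ≤ b` for the bottom one; the half-turn determines the
upper half and forces `h a 0 = h 0 a`. The unit increments of `C` become the inequalities of
`IsDiagonalHeight`. These describe the number of cells `(t, a+t, b+t)` of a cyclically symmetric
plane partition: rotating the least coordinate to the front shows that such diagonals contain
everything, and `h a 0 = h 0 a` is the compatibility when the least coordinate is attained twice. -/

/-! ### Punctured versions of the nested coupling -/

theorem mem_puncturedRarest_iff {k n a b : ℕ} :
    s(a, b) ∈ puncturedRarest k n ↔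
      (∃ i, 1 ≤ i ∧ i ≤ k ∧ (((a = i ∧ b = 4 * n + 1 - i) ∨ (a = 4 * n + 1 - i ∧ b = i)) ∨
        ((a = 2 * n + i ∧ b = 2 * n + 1 - i) ∨ (a = 2 * n + 1 - i ∧ b = 2 * n + i)))) ∨
      (∃ i, k < i ∧ i ≤ n ∧ (((a = i ∧ b = 2 * n + 1 - i) ∨ (a = 2 * n + 1 - i ∧ b = i)) ∨
        ((a = 2 * n + i ∧ b = 4 * n + 1 - i) ∨ (a = 4 * n + 1 - i ∧ b = 2 * n + i)))) := by
  simp only [puncturedRarest, Set.mem_union, Set.mem_ofPred_eq, Sym2.eq_iff]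

theorem mem_puncturedRarest {k n a b : ℕ} (hk : k ≤ n) :
    s(a, b) ∈ puncturedRarest k n ↔
      1 ≤ a ∧ a ≤ 4 * n ∧ 1 ≤ b ∧ b ≤ 4 * n ∧
      ((a + b = 4 * n + 1 ∧ (a ≤ k ∨ b ≤ k ∨ (2 * n < a ∧ a ≤ 2 * n + k) ∨
          (2 * n < b ∧ b ≤ 2 * n + k))) ∨
       (a + b = 2 * n + 1 ∧ k < a ∧ k < b) ∨
       (a + b = 6 * n + 1 ∧ 2 * n + k < a ∧ 2 * n + k < b)) := by
  rw [mem_puncturedRarest_iff]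
  constructor
  · rintro (⟨i, h⟩ | ⟨i, h⟩) <;> omega
  · intro h
    by_cases h1 : a + b = 4 * n + 1
    · left
      by_cases ha : a ≤ k
      · exact ⟨a, by omega⟩
      by_cases hb : b ≤ k
      · exact ⟨b, by omega⟩
      by_cases hc : 2 * n < a
      · exact ⟨a - 2 * n, by omega⟩
      · exact ⟨b - 2 * n, by omega⟩
    · right
      by_cases ha : a ≤ n
      · exact ⟨a, by omega⟩
      by_cases hb : b ≤ n
      · exact ⟨b, by omega⟩
      by_cases hc : a ≤ 3 * n
      · exact ⟨a - 2 * n, by omega⟩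
      · exact ⟨b - 2 * n, by omega⟩

theorem mem_rarestCoupling {n a b : ℕ} :
    s(a, b) ∈ rarestCoupling n ↔ 1 ≤ a ∧ 1 ≤ b ∧ a + b = 2 * n + 1 := by
  simp only [rarestCoupling, Set.mem_ofPred_eq, Sym2.eq_iff]
  constructor
  · rintro ⟨i, h⟩
    omega
  · intro h
    by_cases ha : a ≤ n
    · exact ⟨a, by omega⟩
    · exact ⟨b, by omega⟩

theorem exists_mem_puncturedRarest {k n a : ℕ} (hk : k ≤ n) (h1 : 1 ≤ a) (h2 : a ≤ 4 * n) :
    ∃ b, s(a, b) ∈ puncturedRarest k n := by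
  simp only [mem_puncturedRarest hk]
  by_cases ha : k < a ∧ a + k ≤ 2 * n
  · exact ⟨2 * n + 1 - a, by omega⟩
  by_cases hb : 2 * n + k < a ∧ a + k ≤ 4 * n
  · exact ⟨6 * n + 1 - a, by omega⟩
  · exact ⟨4 * n + 1 - a, by omega⟩

theorem isCoupling_puncturedRarest {k n : ℕ} (hk : k ≤ n) :
    IsCoupling (2 * n) (puncturedRarest k n) where
  mem_range := by
    intro e
    induction e with | _ a b
    intro he i hi
    rw [mem_puncturedRarest hk] at he
    rcases Sym2.mem_iff.1 hi with rfl | rfl <;> omega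
  not_isDiag := by
    intro e
    induction e with | _ a b
    intro he h
    rw [mem_puncturedRarest hk] at he
    rw [Sym2.mk_isDiag_iff] at h
    omega
  existsUnique_mem := by
    intro i h1 h2
    obtain ⟨b, hb⟩ := exists_mem_puncturedRarest hk h1 (show i ≤ 4 * n by omega)
    refine ⟨s(i, b), ⟨hb, Sym2.mem_mk_left _ _⟩, ?_⟩
    rintro e ⟨he, hi⟩
    obtain ⟨d, rfl⟩ := hi
    rw [mem_puncturedRarest hk] at he hb
    congr 1
    have : d = b := by omega
    rw [this]
  noncrossing := by
    intro i k j l h1 h2 h3 h h'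
    rw [mem_puncturedRarest hk] at h h'
    omega

theorem mem_map_image_iff {f : ℕ → ℕ} {c : Set (Sym2 ℕ)} {a b : ℕ} :
    s(a, b) ∈ Sym2.map f '' c ↔ ∃ x y, s(x, y) ∈ c ∧ f x = a ∧ f y = b := by
  constructor
  · rintro ⟨e, he, h⟩
    induction e with | _ x y
    rw [Sym2.map_mk, Sym2.eq_iff] at h
    rcases h with ⟨h1, h2⟩ | ⟨h1, h2⟩
    · exact ⟨x, y, he, h1, h2⟩
    · exact ⟨y, x, by rwa [Sym2.eq_swap], h2, h1⟩
  · rintro ⟨x, y, h, rfl, rfl⟩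
    exact ⟨_, h, Sym2.map_mk _ _ _⟩

theorem isPuncturedVersion_puncturedRarest {k n : ℕ} (hk : k ≤ n) :
    IsPuncturedVersion n (rarestCoupling n) (puncturedRarest k n) := by
  refine ⟨⟨isCoupling_puncturedRarest hk, ?_⟩, ?_⟩
  · ext e
    induction e with | _ a b
    rw [mem_map_image_iff]
    simp only [mem_puncturedRarest hk, labelHalfTurn]
    constructor
    · rintro ⟨x, y, h, h1, h2⟩
      split_ifs at h1 h2 <;> omega
    · intro h
      refine ⟨if a ≤ 2 * n then a + 2 * n else a - 2 * n,
        if b ≤ 2 * n then b + 2 * n else b - 2 * n, ?_⟩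
      split_ifs <;> omega
  · ext e
    induction e with | _ a b
    rw [forgetPuncture, mem_map_image_iff]
    simp only [mem_puncturedRarest hk, mem_rarestCoupling, labelFold]
    constructor
    · rintro ⟨x, y, h, h1, h2⟩
      split_ifs at h1 h2 <;> omega
    · intro h
      -- If one label is at most `k`, the pair is long and its other end is the lift by `2n`;
      -- otherwise the short pair itself is a preimage.
      by_cases ha : a ≤ k
      · exact ⟨a, b + 2 * n, by split_ifs <;> omega⟩
      by_cases hb : b ≤ k
      · exact ⟨a + 2 * n, b, by split_ifs <;> omega⟩
      · exact ⟨a, b, by split_ifs <;> omega⟩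

/-- Folding gives a pair with sum `2n+1`, hence with one label in each half of `{1, …, 2n}`;
unfolding adds 0, `2n` or `4n` to the sum. The last two clauses forbid pairs inside the left side
and inside the bottom side. -/
theorem fold_add_eq {n : ℕ} {c : Set (Sym2 ℕ)} (h : IsPuncturedVersion n (rarestCoupling n) c)
    {a b : ℕ} (hab : s(a, b) ∈ c) :
    1 ≤ a ∧ a ≤ 4 * n ∧ 1 ≤ b ∧ b ≤ 4 * n ∧
      (a + b = 2 * n + 1 ∨ a + b = 4 * n + 1 ∨ a + b = 6 * n + 1) ∧
      ¬ (a ≤ n ∧ b ≤ n) ∧ ¬ (n < a ∧ a ≤ 2 * n ∧ n < b ∧ b ≤ 2 * n) := by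
  have ha := h.1.1.mem_range _ hab a (Sym2.mem_mk_left _ _)
  have hb := h.1.1.mem_range _ hab b (Sym2.mem_mk_right _ _)
  have hf : s(labelFold (2 * n) a, labelFold (2 * n) b) ∈ rarestCoupling n := by
    rw [← h.2, forgetPuncture, mem_map_image_iff]
    exact ⟨a, b, hab, rfl, rfl⟩
  rw [mem_rarestCoupling, labelFold, labelFold] at hf
  split_ifs at hf <;> omega

theorem exists_eq_puncturedRarest {n : ℕ} {c : Set (Sym2 ℕ)}
    (h : IsPuncturedVersion n (rarestCoupling n) c) : ∃ k ≤ n, c = puncturedRarest k n := by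
  have hex : ∀ i, 1 ≤ i → i ≤ 4 * n → ∃ j, s(i, j) ∈ c := by
    intro i h1 h2
    obtain ⟨e, ⟨he, hi⟩, -⟩ := h.1.1.existsUnique_mem i h1 (by omega)
    obtain ⟨j, rfl⟩ := hi
    exact ⟨j, he⟩
  have huniq : ∀ i j j', s(i, j) ∈ c → s(i, j') ∈ c → j = j' := by
    intro i j j' hj hj'
    have hi := h.1.1.mem_range _ hj i (Sym2.mem_mk_left _ _)
    have := (h.1.1.existsUnique_mem i hi.1 hi.2).unique ⟨hj, Sym2.mem_mk_left _ _⟩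
      ⟨hj', Sym2.mem_mk_left _ _⟩
    exact Sym2.congr_right.1 this
  have hturn : ∀ i j, s(i, j) ∈ c →
      s(labelHalfTurn (2 * n) i, labelHalfTurn (2 * n) j) ∈ c := by
    intro i j hij
    rw [← h.1.2, mem_map_image_iff]
    exact ⟨i, j, hij, rfl, rfl⟩
  -- A short partner `2n+1-i` would lie strictly between `i'` and `4n+1-i'`, with `i` outside: a
  -- crossing.
  have hmono : ∀ i i', 1 ≤ i → i < i' → i' ≤ n → s(i', 4 * n + 1 - i') ∈ c →
      s(i, 4 * n + 1 - i) ∈ c := by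
    intro i i' h1 h2 h3 hi'
    obtain ⟨j, hj⟩ := hex i h1 (by omega)
    have := fold_add_eq h hj
    by_cases hj2 : j = 4 * n + 1 - i
    · rwa [← hj2]
    · exact absurd hi' (h.1.1.noncrossing i i' j _ h2 (by omega) (by omega) hj)
  classical
  -- The last label with a long pair; the default value 0 is right when all pairs are short.
  set k := Nat.findGreatest (fun k => 1 ≤ k ∧ s(k, 4 * n + 1 - k) ∈ c) n with hkdef
  have hkn : k ≤ n := Nat.findGreatest_le n
  have hlong : ∀ i, 1 ≤ i → i ≤ k → s(i, 4 * n + 1 - i) ∈ c := by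
    intro i h1 h2
    have hk := Nat.findGreatest_of_ne_zero hkdef.symm (by omega)
    rcases Nat.lt_or_eq_of_le h2 with h2 | h2
    · exact hmono i k h1 h2 hkn hk.2
    · rw [h2]
      exact hk.2
  have hshort : ∀ i, k < i → i ≤ n → s(i, 2 * n + 1 - i) ∈ c := by
    intro i h1 h2
    obtain ⟨j, hj⟩ := hex i (by omega) (by omega)
    have := fold_add_eq h hj
    by_cases hj2 : j = 4 * n + 1 - i
    · have hg := Nat.findGreatest_is_greatest (P := fun k => 1 ≤ k ∧ s(k, 4 * n + 1 - k) ∈ c)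
        (n := n) h1 h2
      exact absurd ⟨by omega, hj2 ▸ hj⟩ hg
    · rwa [show 2 * n + 1 - i = j by omega]
  have hsub : ∀ a b, s(a, b) ∈ puncturedRarest k n → s(a, b) ∈ c := by
    intro a b hab
    rw [mem_puncturedRarest_iff] at hab
    rcases hab with ⟨i, h1, h2, hab⟩ | ⟨i, h1, h2, hab⟩
    · have h3 := hlong i h1 h2
      have h4 := hturn _ _ h3
      rw [labelHalfTurn, labelHalfTurn, if_pos (by omega), if_neg (by omega),
        show i + 2 * n = 2 * n + i by omega,
        show 4 * n + 1 - i - 2 * n = 2 * n + 1 - i by omega] at h4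
      rcases hab with (⟨rfl, rfl⟩ | ⟨rfl, rfl⟩) | (⟨rfl, rfl⟩ | ⟨rfl, rfl⟩)
      · exact h3
      · rwa [Sym2.eq_swap]
      · exact h4
      · rwa [Sym2.eq_swap]
    · have h3 := hshort i h1 h2
      have h4 := hturn _ _ h3
      rw [labelHalfTurn, labelHalfTurn, if_pos (by omega), if_pos (by omega),
        show i + 2 * n = 2 * n + i by omega,
        show 2 * n + 1 - i + 2 * n = 4 * n + 1 - i by omega] at h4
      rcases hab with (⟨rfl, rfl⟩ | ⟨rfl, rfl⟩) | (⟨rfl, rfl⟩ | ⟨rfl, rfl⟩)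
      · exact h3
      · rwa [Sym2.eq_swap]
      · exact h4
      · rwa [Sym2.eq_swap]
  refine ⟨k, hkn, Set.Subset.antisymm ?_ ?_⟩
  · intro e
    induction e with | _ a b
    intro he
    have ha := h.1.1.mem_range _ he a (Sym2.mem_mk_left _ _)
    obtain ⟨b', hb'⟩ := exists_mem_puncturedRarest hkn ha.1 (show a ≤ 4 * n by omega)
    rwa [huniq a b b' he (hsub _ _ hb')]
  · intro e
    induction e with | _ a b
    exact hsub a b

theorem isPuncturedVersion_rarestCoupling_iff (n : ℕ) (c : Set (Sym2 ℕ)) :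
    IsPuncturedVersion n (rarestCoupling n) c ↔ ∃ k ≤ n, c = puncturedRarest k n :=
  ⟨exists_eq_puncturedRarest, fun ⟨_, hk, h⟩ => h ▸ isPuncturedVersion_puncturedRarest hk⟩

/-- The long pair `{i, 4n+1-i}` with `1 ≤ i ≤ n` occurs exactly when `i ≤ k`, so `k` can be read
off. -/
theorem puncturedRarest_injOn (n : ℕ) :
    Set.InjOn (fun k => puncturedRarest k n) (Set.Iic n) := by
  intro k hk l hl h
  simp only [Set.mem_Iic] at hk hl
  have key : ∀ i, 1 ≤ i → i ≤ n → (i ≤ k ↔ i ≤ l) := by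
    intro i h1 h2
    have h3 : s(i, 4 * n + 1 - i) ∈ puncturedRarest k n ↔
      s(i, 4 * n + 1 - i) ∈ puncturedRarest l n := by
      simp only at h
      rw [h]
    rw [mem_puncturedRarest hk, mem_puncturedRarest hl] at h3
    omega
  have h1 := key k
  have h2 := key l
  omega

theorem ncard_isPuncturedVersion (n : ℕ) :
    {c : Set (Sym2 ℕ) | IsPuncturedVersion n (rarestCoupling n) c}.ncard = n + 1 := by
  have : {c : Set (Sym2 ℕ) | IsPuncturedVersion n (rarestCoupling n) c} =
      (fun k => puncturedRarest k n) '' Set.Iic n := by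
    ext c
    rw [Set.mem_ofPred_eq, isPuncturedVersion_rarestCoupling_iff]
    exact ⟨fun ⟨k, hk, h⟩ => ⟨k, hk, h.symm⟩, fun ⟨k, hk, h⟩ => ⟨k, hk, h.symm⟩⟩
  rw [this, (puncturedRarest_injOn n).ncard_image, Set.ncard_eq_toFinset_card']
  simp

/-! ### Corner-sum functions and the graphs they encode -/

/-- The corner-sum functions of alternating sign matrices of size `N`, as functions on the faces of
the `N × N` grid. -/
structure IsCornerSum (N : ℤ) (C : ℤ → ℤ → ℤ) : Prop where
  left : ∀ y, 0 ≤ y → y ≤ N → C 0 y = 0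
  bottom : ∀ x, 0 ≤ x → x ≤ N → C x 0 = 0
  right : ∀ y, 0 ≤ y → y ≤ N → C N y = y
  top : ∀ x, 0 ≤ x → x ≤ N → C x N = x
  step_x : ∀ x y, 1 ≤ x → x ≤ N → 0 ≤ y → y ≤ N →
    C (x - 1) y ≤ C x y ∧ C x y ≤ C (x - 1) y + 1
  step_y : ∀ x y, 0 ≤ x → x ≤ N → 1 ≤ y → y ≤ N →
    C x (y - 1) ≤ C x y ∧ C x y ≤ C x (y - 1) + 1

/-- The graph `G` is described by the function `C` on faces: an edge is present or absent according
to whether `C` is constant across it, with a convention depending on the parity of the edge. -/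
structure Encodes (N p : ℤ) (C : ℤ → ℤ → ℤ) (G : SimpleGraph (ℤ × ℤ)) : Prop where
  horiz : ∀ x y, 0 ≤ x → x ≤ N → 1 ≤ y → y ≤ N →
    (G.Adj (x, y) (x + 1, y) ↔ (C x y = C x (y - 1) ↔ (x + y + p) % 2 = 0))
  vert : ∀ x y, 1 ≤ x → x ≤ N → 0 ≤ y → y ≤ N →
    (G.Adj (x, y) (x, y + 1) ↔ (C x y = C (x - 1) y ↔ (x + y + p) % 2 = 1))

theorem abs_add_abs_eq_one {a b : ℤ} (h : |a| + |b| = 1) :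
    (a = 1 ∧ b = 0) ∨ (a = -1 ∧ b = 0) ∨ (a = 0 ∧ b = 1) ∨ (a = 0 ∧ b = -1) := by
  rcases abs_cases a with ⟨h1, h2⟩ | ⟨h1, h2⟩ <;> rcases abs_cases b with ⟨h3, h4⟩ | ⟨h3, h4⟩ <;>
    omega

/-- To prove a symmetric property of all edges, it suffices to consider the edges that go to the
right or upwards. -/
theorem FPL.adj_induction {N : ℕ} (f : FPL N) {P : ℤ × ℤ → ℤ × ℤ → Prop}
    (hs : ∀ u v, P u v → P v u)
    (hh : ∀ x y : ℤ, 0 ≤ x → x ≤ N → 1 ≤ y → y ≤ N → f.graph.Adj (x, y) (x + 1, y) →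
      P (x, y) (x + 1, y))
    (hv : ∀ x y : ℤ, 1 ≤ x → x ≤ N → 0 ≤ y → y ≤ N → f.graph.Adj (x, y) (x, y + 1) →
      P (x, y) (x, y + 1)) (u v : ℤ × ℤ) (h : f.graph.Adj u v) : P u v := by
  obtain ⟨a, b⟩ := u
  obtain ⟨c, d⟩ := v
  have h1 := f.lattice _ _ h
  have h2 := f.meets_grid _ _ h
  simp only [grid, Set.mem_ofPred_eq] at h2
  rcases abs_add_abs_eq_one h1 with h3 | h3 | h3 | h3 <;> simp only at h3
  · obtain rfl : a = c + 1 := by omega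
    obtain rfl : b = d := by omega
    exact hs _ _ (hh _ _ (by omega) (by omega) (by omega) (by omega) h.symm)
  · obtain rfl : c = a + 1 := by omega
    obtain rfl : b = d := by omega
    exact hh _ _ (by omega) (by omega) (by omega) (by omega) h
  · obtain rfl : b = d + 1 := by omega
    obtain rfl : a = c := by omega
    exact hs _ _ (hv _ _ (by omega) (by omega) (by omega) (by omega) h.symm)
  · obtain rfl : d = b + 1 := by omega
    obtain rfl : a = c := by omega
    exact hv _ _ (by omega) (by omega) (by omega) (by omega) h

theorem FPL.ext_of_le {N : ℕ} {f g : FPL N}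
    (h : ∀ u v, f.graph.Adj u v → g.graph.Adj u v)
    (h' : ∀ u v, g.graph.Adj u v → f.graph.Adj u v) : f = g := by
  have : f.graph = g.graph := by
    ext u v
    exact ⟨h u v, h' u v⟩
  cases f
  cases g
  simp only at this
  subst this
  rfl

theorem FPL.eq_of_encodes {N : ℕ} {p : ℤ} {C : ℤ → ℤ → ℤ} {f g : FPL N}
    (hf : Encodes N p C f.graph) (hg : Encodes N p C g.graph) : f = g := by
  apply FPL.ext_of_le
  · refine f.adj_induction (fun u v h => h.symm) ?_ ?_
    · intro x y h1 h2 h3 h4 h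
      rwa [hg.horiz x y h1 h2 h3 h4, ← hf.horiz x y h1 h2 h3 h4]
    · intro x y h1 h2 h3 h4 h
      rwa [hg.vert x y h1 h2 h3 h4, ← hf.vert x y h1 h2 h3 h4]
  · refine g.adj_induction (fun u v h => h.symm) ?_ ?_
    · intro x y h1 h2 h3 h4 h
      rwa [hf.horiz x y h1 h2 h3 h4, ← hg.horiz x y h1 h2 h3 h4]
    · intro x y h1 h2 h3 h4 h
      rwa [hf.vert x y h1 h2 h3 h4, ← hg.vert x y h1 h2 h3 h4]

theorem Encodes.congr {N p : ℤ} {C D : ℤ → ℤ → ℤ} {G : SimpleGraph (ℤ × ℤ)}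
    (h : Encodes N p C G)
    (hCD : ∀ x y, 0 ≤ x → x ≤ N → 0 ≤ y → y ≤ N → C x y = D x y) : Encodes N p D G where
  horiz x y h1 h2 h3 h4 := by
    rw [h.horiz x y h1 h2 h3 h4, hCD _ _ h1 h2 (by omega) h4,
      hCD _ _ h1 h2 (by omega) (by omega)]
  vert x y h1 h2 h3 h4 := by
    rw [h.vert x y h1 h2 h3 h4, hCD _ _ (by omega) h2 h3 h4,
      hCD _ _ (by omega) (by omega) (by omega) (by omega)]

/-- The graph determines every vertical increment of the function, and the value on the bottom
border is 0. -/
theorem Encodes.unique {N p : ℤ} {C D : ℤ → ℤ → ℤ} {G : SimpleGraph (ℤ × ℤ)}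
    (hC : IsCornerSum N C) (hD : IsCornerSum N D)
    (h : Encodes N p C G) (h' : Encodes N p D G) (x y : ℤ)
    (hx : 0 ≤ x) (hx' : x ≤ N) (hy : 0 ≤ y) (hy' : y ≤ N) : C x y = D x y := by
  induction y, hy using Int.leInduction with
  | base => rw [hC.bottom x hx hx', hD.bottom x hx hx']
  | succ y hy ih =>
    have ih := ih (by omega)
    have h1 := h.horiz x (y + 1) hx hx' (by omega) hy'
    rw [h'.horiz x (y + 1) hx hx' (by omega) hy'] at h1
    have h2 := hC.step_y x (y + 1) hx hx' (by omega) hy'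
    have h3 := hD.step_y x (y + 1) hx hx' (by omega) hy'
    rw [add_sub_cancel_right] at h1 h2 h3
    omega

/-! ### From configurations to corner sums -/

open Classical in
/-- The degree of a vertex in a lattice graph is the sum over the four directions. -/
theorem ncard_neighborSet_eq (G : SimpleGraph (ℤ × ℤ))
    (hG : ∀ u v, G.Adj u v → |u.1 - v.1| + |u.2 - v.2| = 1) (x y : ℤ) :
    (G.neighborSet (x, y)).ncard =
      (if G.Adj (x, y) (x + 1, y) then 1 else 0) +
      (if G.Adj (x - 1, y) (x, y) then 1 else 0) +
      (if G.Adj (x, y) (x, y + 1) then 1 else 0) +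
      (if G.Adj (x, y - 1) (x, y) then 1 else 0) := by
  have : G.neighborSet (x, y) = ↑(({(x + 1, y), (x - 1, y), (x, y + 1), (x, y - 1)} :
      Finset (ℤ × ℤ)).filter (fun v => G.Adj (x, y) v)) := by
    ext ⟨a, b⟩
    simp only [SimpleGraph.mem_neighborSet, Finset.coe_filter, Set.mem_ofPred_eq,
      Finset.mem_insert, Finset.mem_singleton, Prod.mk.injEq]
    constructor
    · intro h
      refine ⟨?_, h⟩
      rcases abs_add_abs_eq_one (hG _ _ h) with h3 | h3 | h3 | h3 <;> simp only at h3 <;> omega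
    · exact fun h => h.2
  rw [this, Set.ncard_coe_finset, Finset.card_filter, Finset.sum_insert, Finset.sum_insert,
    Finset.sum_insert, Finset.sum_singleton, G.adj_comm (x, y) (x - 1, y),
    G.adj_comm (x, y) (x, y - 1)]
  · ring
  all_goals simp <;> omega

open Classical in
/-- The increment of the corner sum across the edge from `(x, y)` to `(x + 1, y)`. -/
noncomputable def FPL.jumpY {N : ℕ} (f : FPL N) (x y : ℤ) : ℤ :=
  if f.graph.Adj (x, y) (x + 1, y) ↔ (x + y) % 2 = 0 then 0 else 1

open Classical in
/-- The increment of the corner sum across the edge from `(x, y)` to `(x, y + 1)`. -/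
noncomputable def FPL.jumpX {N : ℕ} (f : FPL N) (x y : ℤ) : ℤ :=
  if f.graph.Adj (x, y) (x, y + 1) ↔ (x + y) % 2 = 1 then 0 else 1

/-- The corner-sum function of a configuration. -/
noncomputable def FPL.cornerSum {N : ℕ} (f : FPL N) (x y : ℤ) : ℤ :=
  ∑ j ∈ Finset.range y.toNat, f.jumpY x (j + 1)

theorem FPL.cornerSum_zero {N : ℕ} (f : FPL N) (x : ℤ) : f.cornerSum x 0 = 0 := by
  simp [FPL.cornerSum]

theorem FPL.cornerSum_succ {N : ℕ} (f : FPL N) (x y : ℤ) (hy : 0 ≤ y) :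
    f.cornerSum x (y + 1) = f.cornerSum x y + f.jumpY x (y + 1) := by
  lift y to ℕ using hy
  rw [FPL.cornerSum, FPL.cornerSum, show ((y : ℤ) + 1).toNat = y + 1 by omega,
    Finset.sum_range_succ, Int.toNat_natCast]

theorem FPL.jumpY_mem {N : ℕ} (f : FPL N) (x y : ℤ) : f.jumpY x y = 0 ∨ f.jumpY x y = 1 := by
  unfold FPL.jumpY
  split_ifs <;> simp

theorem FPL.jumpX_mem {N : ℕ} (f : FPL N) (x y : ℤ) : f.jumpX x y = 0 ∨ f.jumpX x y = 1 := by
  unfold FPL.jumpX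
  split_ifs <;> simp

theorem FPL.jumpY_eq_zero {N : ℕ} (f : FPL N) (x y : ℤ) :
    f.jumpY x y = 0 ↔ (f.graph.Adj (x, y) (x + 1, y) ↔ (x + y) % 2 = 0) := by
  unfold FPL.jumpY
  split_ifs with h
  · exact ⟨fun _ => h, fun _ => rfl⟩
  · exact ⟨fun h' => absurd h' one_ne_zero, fun h' => absurd h' h⟩

theorem FPL.jumpX_eq_zero {N : ℕ} (f : FPL N) (x y : ℤ) :
    f.jumpX x y = 0 ↔ (f.graph.Adj (x, y) (x, y + 1) ↔ (x + y) % 2 = 1) := by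
  unfold FPL.jumpX
  split_ifs with h
  · exact ⟨fun _ => h, fun _ => rfl⟩
  · exact ⟨fun h' => absurd h' one_ne_zero, fun h' => absurd h' h⟩

/-- Let `R, L, U, D` be the indicators of the four edges at the vertex. If `x + y` is even, the four
jumps are `1-R, L, U, 1-D`; if it is odd, all four are complemented. In both cases the identity
reads `R + L + U + D = 2`. -/
theorem FPL.jump_vertex {N : ℕ} (f : FPL N) (x y : ℤ) (h1 : 1 ≤ x) (h2 : x ≤ N) (h3 : 1 ≤ y)
    (h4 : y ≤ N) : f.jumpY x y - f.jumpY (x - 1) y = f.jumpX x y - f.jumpX x (y - 1) := by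
  have h := f.degree_eq_two (x, y) ⟨h1, h2, h3, h4⟩
  rw [ncard_neighborSet_eq _ f.lattice] at h
  have a1 := f.jumpY_mem x y
  have a2 := f.jumpY_mem (x - 1) y
  have a3 := f.jumpX_mem x y
  have a4 := f.jumpX_mem x (y - 1)
  have b1 := f.jumpY_eq_zero x y
  have b2 := f.jumpY_eq_zero (x - 1) y
  have b3 := f.jumpX_eq_zero x y
  have b4 := f.jumpX_eq_zero x (y - 1)
  rw [sub_add_cancel] at b2 b4
  by_cases c1 : f.graph.Adj (x, y) (x + 1, y) <;>
  by_cases c2 : f.graph.Adj (x - 1, y) (x, y) <;>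
  by_cases c3 : f.graph.Adj (x, y) (x, y + 1) <;>
  by_cases c4 : f.graph.Adj (x, y - 1) (x, y) <;>
  simp only [c1, c2, c3, c4, if_true, if_false, true_iff, false_iff] at h b1 b2 b3 b4 <;> omega

theorem FPL.adj_left {n : ℕ} (f : FPL (2 * n)) (y : ℤ) (h1 : 1 ≤ y) (h2 : y ≤ 2 * n) :
    f.graph.Adj (0, y) (1, y) ↔ y % 2 = 0 := by
  have h := f.boundary (2 * n - y).toNat (by omega)
  rw [outerVertex, innerVertex, if_pos (by omega), if_pos (by omega),
    show ((2 * n : ℕ) : ℤ) - ((2 * n - y).toNat : ℕ) = y by omega] at h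
  rw [h, Nat.even_iff]
  omega

theorem FPL.adj_bottom {n : ℕ} (f : FPL (2 * n)) (x : ℤ) (h1 : 1 ≤ x) (h2 : x ≤ 2 * n) :
    f.graph.Adj (x, 0) (x, 1) ↔ x % 2 = 1 := by
  have h := f.boundary (2 * n + x - 1).toNat (by omega)
  rw [outerVertex, innerVertex, if_neg (by omega), if_pos (by omega), if_neg (by omega),
    if_pos (by omega),
    show ((2 * n + x - 1).toNat : ℤ) - ((2 * n : ℕ) : ℤ) + 1 = x by omega] at h
  rw [h, Nat.even_iff]
  omega

theorem FPL.adj_right {n : ℕ} (f : FPL (2 * n)) (y : ℤ) (h1 : 1 ≤ y) (h2 : y ≤ 2 * n) :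
    f.graph.Adj (2 * (n : ℤ), y) (2 * (n : ℤ) + 1, y) ↔ y % 2 = 1 := by
  have h := f.boundary (4 * n + y - 1).toNat (by omega)
  rw [outerVertex, innerVertex, if_neg (by omega), if_neg (by omega), if_pos (by omega),
    if_neg (by omega), if_neg (by omega), if_pos (by omega),
    show ((4 * n + y - 1).toNat : ℤ) - 2 * ((2 * n : ℕ) : ℤ) + 1 = y by omega,
    f.graph.adj_comm] at h
  push_cast at h
  rw [h, Nat.even_iff]
  omega

theorem FPL.adj_top {n : ℕ} (f : FPL (2 * n)) (x : ℤ) (h1 : 1 ≤ x) (h2 : x ≤ 2 * n) :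
    f.graph.Adj (x, 2 * (n : ℤ)) (x, 2 * (n : ℤ) + 1) ↔ x % 2 = 0 := by
  have h := f.boundary (8 * n - x).toNat (by omega)
  rw [outerVertex, innerVertex, if_neg (by omega), if_neg (by omega), if_neg (by omega),
    if_neg (by omega), if_neg (by omega), if_neg (by omega),
    show 4 * ((2 * n : ℕ) : ℤ) - ((8 * n - x).toNat : ℤ) = x by omega,
    f.graph.adj_comm] at h
  push_cast at h
  rw [h, Nat.even_iff]
  omega

/-- The sum was taken along columns; `jump_vertex` makes it path independent, starting from the
bottom border, where both sides vanish. -/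
theorem FPL.cornerSum_step {n : ℕ} (f : FPL (2 * n)) (x y : ℤ) (h1 : 1 ≤ x) (h2 : x ≤ 2 * n)
    (h3 : 0 ≤ y) (h4 : y ≤ 2 * n) :
    f.cornerSum x y = f.cornerSum (x - 1) y + f.jumpX x y := by
  induction y, h3 using Int.leInduction with
  | base =>
    rw [FPL.cornerSum_zero, FPL.cornerSum_zero, FPL.jumpX, if_pos]
    · ring
    · rw [zero_add, f.adj_bottom x h1 h2, add_zero]
  | succ y hy ih =>
    have := f.jump_vertex x (y + 1) h1 (by push_cast; omega) (by omega) (by push_cast; omega)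
    rw [add_sub_cancel_right] at this
    rw [f.cornerSum_succ x y hy, f.cornerSum_succ (x - 1) y hy]
    linarith [ih (by omega)]

theorem FPL.cornerSum_left {n : ℕ} (f : FPL (2 * n)) (y : ℤ) (h1 : 0 ≤ y) (h2 : y ≤ 2 * n) :
    f.cornerSum 0 y = 0 := by
  induction y, h1 using Int.leInduction with
  | base => exact f.cornerSum_zero 0
  | succ y hy ih =>
    rw [f.cornerSum_succ 0 y hy, ih (by omega), (f.jumpY_eq_zero 0 (y + 1)).2]
    · rfl
    · rw [zero_add, f.adj_left (y + 1) (by omega) h2, zero_add]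

theorem FPL.isCornerSum {n : ℕ} (f : FPL (2 * n)) : IsCornerSum (2 * n) f.cornerSum where
  left y h1 h2 := f.cornerSum_left y h1 h2
  bottom x _ _ := f.cornerSum_zero x
  right y h1 h2 := by
    induction y, h1 using Int.leInduction with
    | base => exact f.cornerSum_zero _
    | succ y hy ih =>
      rw [f.cornerSum_succ _ y hy, ih (by omega)]
      rcases f.jumpY_mem (2 * n) (y + 1) with h | h
      · rw [f.jumpY_eq_zero, f.adj_right (y + 1) (by omega) h2] at h
        omega
      · rw [h]
  top x h1 h2 := by
    induction x, h1 using Int.leInduction with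
    | base => exact f.cornerSum_left _ (by omega) le_rfl
    | succ x hx ih =>
      rw [f.cornerSum_step (x + 1) _ (by omega) h2 (by omega) le_rfl, add_sub_cancel_right,
        ih (by omega)]
      rcases f.jumpX_mem (x + 1) (2 * n) with h | h
      · rw [f.jumpX_eq_zero, f.adj_top (x + 1) (by omega) h2] at h
        omega
      · rw [h]
  step_x x y h1 h2 h3 h4 := by
    have := f.cornerSum_step x y h1 h2 h3 h4
    have := f.jumpX_mem x y
    omega
  step_y x y h1 h2 h3 h4 := by
    have h := f.cornerSum_succ x (y - 1) (by omega)
    rw [sub_add_cancel] at h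
    have := f.jumpY_mem x y
    omega

theorem iff_swap {a b c : Prop} (h : a ↔ (b ↔ c)) : b ↔ (a ↔ c) := by tauto

theorem FPL.encodes_cornerSum {n : ℕ} (f : FPL (2 * n)) :
    Encodes (2 * n) 0 f.cornerSum f.graph where
  horiz x y h1 h2 h3 h4 := by
    have h := f.cornerSum_succ x (y - 1) (by omega)
    rw [sub_add_cancel] at h
    rw [add_zero]
    apply iff_swap
    rw [← f.jumpY_eq_zero]
    omega
  vert x y h1 h2 h3 h4 := by
    have h := f.cornerSum_step x y h1 h2 h3 h4
    rw [add_zero]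
    apply iff_swap
    rw [← f.jumpX_eq_zero]
    omega

/-! ### From corner sums to configurations -/

/-- The edge from `(x, y)` to `(x + 1, y)` is present in the graph described by `C`. -/
def HorizEdge (C : ℤ → ℤ → ℤ) (x y : ℤ) : Prop := C x y = C x (y - 1) ↔ (x + y) % 2 = 0

/-- The edge from `(x, y)` to `(x, y + 1)` is present in the graph described by `C`. -/
def VertEdge (C : ℤ → ℤ → ℤ) (x y : ℤ) : Prop := C x y = C (x - 1) y ↔ (x + y) % 2 = 1

/-- The graph described by a function on the faces of the `N × N` grid. -/
def cornerGraph (N : ℕ) (C : ℤ → ℤ → ℤ) : SimpleGraph (ℤ × ℤ) where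
  Adj u v := (u ∈ grid N ∨ v ∈ grid N) ∧
    ((v.1 = u.1 + 1 ∧ v.2 = u.2 ∧ HorizEdge C u.1 u.2) ∨
      (u.1 = v.1 + 1 ∧ u.2 = v.2 ∧ HorizEdge C v.1 v.2) ∨
      (v.1 = u.1 ∧ v.2 = u.2 + 1 ∧ VertEdge C u.1 u.2) ∨
      (u.1 = v.1 ∧ u.2 = v.2 + 1 ∧ VertEdge C v.1 v.2))
  symm := ⟨fun u v h => by tauto⟩
  loopless := ⟨fun u h => by omega⟩

theorem cornerGraph_horiz {N : ℕ} {C : ℤ → ℤ → ℤ} {x y : ℤ} (h1 : 0 ≤ x) (h2 : x ≤ N)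
    (h3 : 1 ≤ y) (h4 : y ≤ N) (hN : 1 ≤ N) :
    (cornerGraph N C).Adj (x, y) (x + 1, y) ↔ HorizEdge C x y := by
  simp only [cornerGraph, grid, Set.mem_ofPred_eq]
  constructor
  · rintro ⟨-, h | h | h | h⟩
    · exact h.2.2
    all_goals omega
  · intro h
    exact ⟨by omega, Or.inl ⟨trivial, trivial, h⟩⟩

theorem cornerGraph_vert {N : ℕ} {C : ℤ → ℤ → ℤ} {x y : ℤ} (h1 : 1 ≤ x) (h2 : x ≤ N)
    (h3 : 0 ≤ y) (h4 : y ≤ N) (hN : 1 ≤ N) :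
    (cornerGraph N C).Adj (x, y) (x, y + 1) ↔ VertEdge C x y := by
  simp only [cornerGraph, grid, Set.mem_ofPred_eq]
  constructor
  · rintro ⟨-, h | h | h | h⟩
    · omega
    · omega
    · exact h.2.2
    · omega
  · intro h
    exact ⟨by omega, Or.inr (Or.inr (Or.inl ⟨trivial, trivial, h⟩))⟩

theorem encodes_cornerGraph (N : ℕ) (C : ℤ → ℤ → ℤ) : Encodes N 0 C (cornerGraph N C) where
  horiz x y h1 h2 h3 h4 := by
    rw [cornerGraph_horiz h1 h2 h3 h4 (by omega), add_zero, HorizEdge]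
  vert x y h1 h2 h3 h4 := by
    rw [cornerGraph_vert h1 h2 h3 h4 (by omega), add_zero, VertEdge]

theorem cornerGraph_lattice {N : ℕ} {C : ℤ → ℤ → ℤ} (u v : ℤ × ℤ)
    (h : (cornerGraph N C).Adj u v) : |u.1 - v.1| + |u.2 - v.2| = 1 := by
  rcases h with ⟨-, ⟨h1, h2, -⟩ | ⟨h1, h2, -⟩ | ⟨h1, h2, -⟩ | ⟨h1, h2, -⟩⟩ <;> simp [h1, h2]

/-- The computation of `jump_vertex` read backwards: the increments of a function around a vertex
always close up. -/
theorem cornerGraph_degree {N : ℕ} {C : ℤ → ℤ → ℤ} (hC : IsCornerSum N C) (v : ℤ × ℤ)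
    (hv : v ∈ grid N) : ((cornerGraph N C).neighborSet v).ncard = 2 := by
  obtain ⟨x, y⟩ := v
  obtain ⟨h1, h2, h3, h4⟩ := hv
  simp only at h1 h2 h3 h4
  have e1 := cornerGraph_horiz (C := C) (x := x) (y := y) (by omega) h2 h3 h4 (by omega)
  have e2 := cornerGraph_horiz (C := C) (x := x - 1) (y := y) (by omega) (by omega) h3 h4 (by omega)
  have e3 := cornerGraph_vert (C := C) (x := x) (y := y) h1 h2 (by omega) h4 (by omega)
  have e4 := cornerGraph_vert (C := C) (x := x) (y := y - 1) h1 h2 (by omega) (by omega) (by omega)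
  rw [sub_add_cancel] at e2 e4
  rw [ncard_neighborSet_eq _ cornerGraph_lattice]
  have a1 := hC.step_x x y h1 h2 (by omega) h4
  have a2 := hC.step_x x (y - 1) h1 h2 (by omega) (by omega)
  have a3 := hC.step_y x y (by omega) h2 h3 h4
  have a4 := hC.step_y (x - 1) y (by omega) (by omega) h3 h4
  simp only [HorizEdge, VertEdge] at e1 e2 e3 e4
  split_ifs with c1 c2 c3 c4 <;> simp only [*, true_iff, false_iff] at e1 e2 e3 e4 <;> omega

theorem cornerGraph_boundary {n : ℕ} {C : ℤ → ℤ → ℤ} (hC : IsCornerSum (2 * n) C) (p : ℕ)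
    (hp : p < 4 * (2 * n)) :
    (cornerGraph (2 * n) C).Adj (outerVertex (2 * n) p) (innerVertex (2 * n) p) ↔ Even p := by
  rw [Nat.even_iff, outerVertex, innerVertex]
  split_ifs with h1 h2 h3
  · have a1 := hC.left (((2 * n : ℕ) : ℤ) - p) (by omega) (by omega)
    have a2 := hC.left (((2 * n : ℕ) : ℤ) - p - 1) (by omega) (by omega)
    have := cornerGraph_horiz (C := C) (x := 0) (y := ((2 * n : ℕ) : ℤ) - p) (N := 2 * n)
      (by omega) (by omega) (by omega) (by omega) (by omega)
    rw [zero_add] at this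
    rw [this, HorizEdge]
    omega
  · have a1 := hC.bottom ((p : ℤ) - (2 * n : ℕ) + 1) (by omega) (by omega)
    have a2 := hC.bottom ((p : ℤ) - (2 * n : ℕ) + 1 - 1) (by omega) (by omega)
    have := cornerGraph_vert (C := C) (x := (p : ℤ) - (2 * n : ℕ) + 1) (y := 0) (N := 2 * n)
      (by omega) (by omega) (by omega) (by omega) (by omega)
    rw [zero_add] at this
    rw [this, VertEdge]
    omega
  · have a1 := hC.right ((p : ℤ) - 2 * (2 * n : ℕ) + 1) (by omega) (by omega)
    have a2 := hC.right ((p : ℤ) - 2 * (2 * n : ℕ) + 1 - 1) (by omega) (by omega)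
    have := cornerGraph_horiz (C := C) (x := (2 * n : ℕ)) (y := (p : ℤ) - 2 * (2 * n : ℕ) + 1)
      (N := 2 * n) (by omega) (by omega) (by omega) (by omega) (by omega)
    rw [SimpleGraph.adj_comm, this, HorizEdge]
    push_cast at a1 a2 ⊢
    omega
  · have a1 := hC.top (4 * ((2 * n : ℕ) : ℤ) - p) (by omega) (by omega)
    have a2 := hC.top (4 * ((2 * n : ℕ) : ℤ) - p - 1) (by omega) (by omega)
    have := cornerGraph_vert (C := C) (x := 4 * ((2 * n : ℕ) : ℤ) - p) (y := (2 * n : ℕ))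
      (N := 2 * n) (by omega) (by omega) (by omega) (by omega) (by omega)
    rw [SimpleGraph.adj_comm, this, VertEdge]
    push_cast at a1 a2 ⊢
    omega

/-- The fully packed loop configuration with a given corner-sum function. -/
def IsCornerSum.toFPL {n : ℕ} {C : ℤ → ℤ → ℤ} (hC : IsCornerSum (2 * n) C) : FPL (2 * n) where
  graph := cornerGraph (2 * n) C
  lattice := cornerGraph_lattice
  meets_grid _ _ h := h.1
  degree_eq_two := cornerGraph_degree (by push_cast; exact hC)
  boundary := cornerGraph_boundary hC

theorem IsCornerSum.encodes_toFPL {n : ℕ} {C : ℤ → ℤ → ℤ} (hC : IsCornerSum (2 * n) C) :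
    Encodes (2 * n) 0 C hC.toFPL.graph := by
  have := encodes_cornerGraph (2 * n) C
  push_cast at this
  exact this

/-! ### Half-turn symmetry -/

/-- Invariance of a corner-sum function under the central symmetry of the grid. -/
def IsHalfTurnSum (N : ℤ) (C : ℤ → ℤ → ℤ) : Prop :=
  ∀ x y, 0 ≤ x → x ≤ N → 0 ≤ y → y ≤ N → C (N - x) (N - y) = N - x - y + C x y

/-- As the size is even, the half-turn reverses the parity of an edge. The image of a present edge
is thus present exactly when an increment `d` goes to `1 - d`, which is what the term `N - x - y`
produces. -/
theorem FPL.isHalfTurnSymmetric_of_isHalfTurnSum {n : ℕ} {C : ℤ → ℤ → ℤ} {f : FPL (2 * n)}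
    (hf : Encodes (2 * n) 0 C f.graph) (hs : IsCornerSum (2 * n) C) (hC : IsHalfTurnSum (2 * n) C) :
    f.IsHalfTurnSymmetric := by
  have key : ∀ u v, f.graph.Adj u v →
      f.graph.Adj (halfTurn (2 * n) u) (halfTurn (2 * n) v) := by
    refine f.adj_induction (fun u v h => h.symm) ?_ ?_
    · intro x y h1 h2 h3 h4 h
      push_cast at h2 h4
      have e := hf.horiz (2 * n - x) (2 * n + 1 - y) (by omega) (by omega) (by omega) (by omega)
      have c1 := hC x (y - 1) (by omega) (by omega) (by omega) (by omega)
      have c2 := hC x y (by omega) (by omega) (by omega) (by omega)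
      have s := hs.step_y x y h1 h2 h3 h4
      rw [hf.horiz x y h1 h2 h3 h4] at h
      rw [show 2 * (n : ℤ) + 1 - y - 1 = 2 * n - y by ring] at e
      rw [show 2 * (n : ℤ) - (y - 1) = 2 * n + 1 - y by ring] at c1
      simp only [halfTurn]
      push_cast
      rw [SimpleGraph.adj_comm, show 2 * (n : ℤ) + 1 - (x + 1) = 2 * n - x by ring,
        show 2 * (n : ℤ) + 1 - x = 2 * n - x + 1 by ring, e]
      omega
    · intro x y h1 h2 h3 h4 h
      push_cast at h2 h4
      have e := hf.vert (2 * n + 1 - x) (2 * n - y) (by omega) (by omega) (by omega) (by omega)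
      have c1 := hC (x - 1) y (by omega) (by omega) (by omega) (by omega)
      have c2 := hC x y (by omega) (by omega) (by omega) (by omega)
      have s := hs.step_x x y h1 h2 h3 h4
      rw [hf.vert x y h1 h2 h3 h4] at h
      rw [show 2 * (n : ℤ) + 1 - x - 1 = 2 * n - x by ring] at e
      rw [show 2 * (n : ℤ) - (x - 1) = 2 * n + 1 - x by ring] at c1
      simp only [halfTurn]
      push_cast
      rw [SimpleGraph.adj_comm, show 2 * (n : ℤ) + 1 - (y + 1) = 2 * n - y by ring,
        show 2 * (n : ℤ) + 1 - y = 2 * n - y + 1 by ring, e]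
      omega
  intro u v
  refine ⟨fun h => ?_, key u v⟩
  have := key _ _ h
  simpa [halfTurn] using this

theorem FPL.isHalfTurnSum_cornerSum {n : ℕ} (f : FPL (2 * n)) (hf : f.IsHalfTurnSymmetric) :
    IsHalfTurnSum (2 * n) f.cornerSum := by
  have hC := f.isCornerSum
  have he := f.encodes_cornerSum
  intro x y h1 h2 h3 h4
  induction y, h3 using Int.leInduction with
  | base => rw [hC.bottom x h1 h2, sub_zero, hC.top _ (by omega) (by omega)]; ring
  | succ y hy ih =>
    have ih := ih (by omega)
    have e1 := he.horiz x (y + 1) h1 h2 (by omega) h4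
    have e2 := he.horiz (2 * n - x) (2 * n - y) (by omega) (by omega) (by omega) (by omega)
    have h := hf (x, y + 1) (x + 1, y + 1)
    simp only [halfTurn] at h
    push_cast at h
    rw [SimpleGraph.adj_comm, show 2 * (n : ℤ) + 1 - (x + 1) = 2 * n - x by ring,
      show 2 * (n : ℤ) + 1 - x = 2 * n - x + 1 by ring,
      show 2 * (n : ℤ) + 1 - (y + 1) = 2 * n - y by ring, e1, e2] at h
    rw [add_sub_cancel_right] at h
    have s1 := hC.step_y x (y + 1) h1 h2 (by omega) h4
    have s2 := hC.step_y (2 * n - x) (2 * n - y) (by omega) (by omega) (by omega) (by omega)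
    rw [add_sub_cancel_right] at s1
    rw [show 2 * (n : ℤ) - y - 1 = 2 * n - (y + 1) by ring] at h s2
    omega

/-! ### Diagonal heights and corner sums -/

/-- The conditions satisfied by the numbers `h a b` of cells `(t, a + t, b + t)` of a cyclically
symmetric plane partition in the `n × n × n` box. -/
structure IsDiagonalHeight (n : ℤ) (h : ℤ → ℤ → ℤ) : Prop where
  anti_left : ∀ a b, 0 ≤ a → a < n → 0 ≤ b → b ≤ n → h (a + 1) b ≤ h a b
  anti_right : ∀ a b, 0 ≤ a → a ≤ n → 0 ≤ b → b < n → h a (b + 1) ≤ h a b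
  diag : ∀ a b, 0 ≤ a → a < n → 0 ≤ b → b < n → h a b ≤ h (a + 1) (b + 1) + 1
  symm : ∀ a, 0 ≤ a → a ≤ n → h a 0 = h 0 a
  zero_left : ∀ b, 0 ≤ b → b ≤ n → h n b = 0
  zero_right : ∀ a, 0 ≤ a → a ≤ n → h a n = 0

namespace IsDiagonalHeight

variable {n : ℤ} {h : ℤ → ℤ → ℤ}

theorem le_left (hh : IsDiagonalHeight n h) (a b : ℤ) (h1 : 0 ≤ a) (h2 : a < n) (h3 : 0 ≤ b)
    (h4 : b ≤ n) : h a b ≤ h (a + 1) b + 1 := by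
  rcases eq_or_lt_of_le h4 with rfl | h4
  · rw [hh.zero_right a h1 h2.le, hh.zero_right (a + 1) (by omega) (by omega)]
    omega
  · linarith [hh.diag a b h1 h2 h3 h4, hh.anti_right (a + 1) b (by omega) (by omega) h3 h4]

theorem le_right (hh : IsDiagonalHeight n h) (a b : ℤ) (h1 : 0 ≤ a) (h2 : a ≤ n) (h3 : 0 ≤ b)
    (h4 : b < n) : h a b ≤ h a (b + 1) + 1 := by
  rcases eq_or_lt_of_le h2 with rfl | h2
  · rw [hh.zero_left b h3 h4.le, hh.zero_left (b + 1) (by omega) (by omega)]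
    omega
  · linarith [hh.diag a b h1 h2 h3 h4, hh.anti_left a (b + 1) h1 h2 (by omega) (by omega)]

/-- The height vanishes at `a = n` and grows by at most one for each step back. -/
theorem le_sub_left (hh : IsDiagonalHeight n h) (a b : ℤ) (h1 : 0 ≤ a) (h2 : a ≤ n) (h3 : 0 ≤ b)
    (h4 : b ≤ n) : h a b ≤ n - a := by
  induction a, h2 using Int.leInductionDown with
  | base => rw [hh.zero_left b h3 h4]; omega
  | pred a h2 ih =>
    have := hh.le_left (a - 1) b h1 (by omega) h3 h4
    rw [sub_add_cancel] at this
    linarith [ih (by omega)]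

theorem le_sub_right (hh : IsDiagonalHeight n h) (a b : ℤ) (h1 : 0 ≤ a) (h2 : a ≤ n) (h3 : 0 ≤ b)
    (h4 : b ≤ n) : h a b ≤ n - b := by
  induction b, h4 using Int.leInductionDown with
  | base => rw [hh.zero_right a h1 h2]; omega
  | pred b h4 ih =>
    have := hh.le_right a (b - 1) h1 h2 h3 (by omega)
    rw [sub_add_cancel] at this
    linarith [ih (by omega)]

theorem nonneg (hh : IsDiagonalHeight n h) (a b : ℤ) (h1 : 0 ≤ a) (h2 : a ≤ n) (h3 : 0 ≤ b)
    (h4 : b ≤ n) : 0 ≤ h a b := by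
  induction a, h2 using Int.leInductionDown with
  | base => rw [hh.zero_left b h3 h4]
  | pred a h2 ih =>
    have := hh.anti_left (a - 1) b h1 (by omega) h3 h4
    rw [sub_add_cancel] at this
    linarith [ih (by omega)]

end IsDiagonalHeight

/-- The values, below the antidiagonal, of the corner-sum function with diagonal heights `h`. -/
def lowerSum (n : ℤ) (h : ℤ → ℤ → ℤ) (x y : ℤ) : ℤ :=
  if x < y then h (n - x) (n - (x + y + 1) / 2) else h (n - (x + y) / 2) (n - y)

/-- The half-turn symmetric corner-sum function with diagonal heights `h`. -/
def sumOfHeight (n : ℤ) (h : ℤ → ℤ → ℤ) (x y : ℤ) : ℤ :=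
  if x + y ≤ 2 * n then lowerSum n h x y
  else x + y - 2 * n + lowerSum n h (2 * n - x) (2 * n - y)

/-- The horizontal edges of the left triangle whose parity is given by `p` are fixed: the function
`C` is constant across them. -/
def IsFrozen (N p : ℤ) (C : ℤ → ℤ → ℤ) : Prop :=
  ∀ x y, 0 ≤ x → x < y → x + y ≤ N → (x + y + p) % 2 = 0 → C x y = C x (y - 1)

section lowerSum

variable {n : ℤ} {h : ℤ → ℤ → ℤ}

theorem lowerSum_left (x y m : ℤ) (h1 : x < y) (h2 : x + y = 2 * m ∨ x + y = 2 * m - 1) :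
    lowerSum n h x y = h (n - x) (n - m) := by
  rw [lowerSum, if_pos h1, show (x + y + 1) / 2 = m by omega]

theorem lowerSum_right (x y m : ℤ) (h1 : y ≤ x) (h2 : x + y = 2 * m ∨ x + y = 2 * m + 1) :
    lowerSum n h x y = h (n - m) (n - y) := by
  rw [lowerSum, if_neg (by omega), show (x + y) / 2 = m by omega]

/-- A unit step in `x` moves the argument of `h` by nothing, by `(1, 0)` or by `(1, 1)`; each of
these changes `h` by 0 or 1, by monotonicity and `diag`. -/
theorem lowerSum_step_x (hh : IsDiagonalHeight n h) (x y : ℤ) (h1 : 1 ≤ x) (h2 : 0 ≤ y)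
    (h3 : x + y ≤ 2 * n) : lowerSum n h (x - 1) y ≤ lowerSum n h x y ∧
      lowerSum n h x y ≤ lowerSum n h (x - 1) y + 1 := by
  obtain ⟨m, hm⟩ : ∃ m, x + y = 2 * m ∨ x + y = 2 * m - 1 := ⟨(x + y + 1) / 2, by omega⟩
  rcases lt_trichotomy x y with hxy | hxy | hxy
  · have e1 := hh.anti_left (n - x) (n - m) (by omega) (by omega) (by omega) (by omega)
    have e2 := hh.le_left (n - x) (n - m) (by omega) (by omega) (by omega) (by omega)
    have e3 := hh.anti_right (n - x + 1) (n - m) (by omega) (by omega) (by omega) (by omega)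
    have e4 := hh.diag (n - x) (n - m) (by omega) (by omega) (by omega) (by omega)
    rw [lowerSum_left x y m hxy hm]
    rcases hm with hm | hm
    · rw [lowerSum_left (x - 1) y m (by omega) (by omega), show n - (x - 1) = n - x + 1 by ring]
      omega
    · rw [lowerSum_left (x - 1) y (m - 1) (by omega) (by omega),
        show n - (x - 1) = n - x + 1 by ring, show n - (m - 1) = n - m + 1 by ring]
      omega
  -- On the main diagonal the step passes from one triangle's formula to the other's; they fit
  -- together as neighbours `(a + 1, a)` and `(a, a)`.
  · obtain rfl : m = x := by omega
    subst hxy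
    have e1 := hh.anti_left (n - m) (n - m) (by omega) (by omega) (by omega) (by omega)
    have e2 := hh.le_left (n - m) (n - m) (by omega) (by omega) (by omega) (by omega)
    rw [lowerSum_right m m m le_rfl (by omega), lowerSum_left (m - 1) m m (by omega) (by omega),
      show n - (m - 1) = n - m + 1 by ring]
    omega
  · rcases hm with hm | hm
    · have e1 := hh.anti_left (n - m) (n - y) (by omega) (by omega) (by omega) (by omega)
      have e2 := hh.le_left (n - m) (n - y) (by omega) (by omega) (by omega) (by omega)
      rw [lowerSum_right x y m (by omega) (by omega),
        lowerSum_right (x - 1) y (m - 1) (by omega) (by omega),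
        show n - (m - 1) = n - m + 1 by ring]
      omega
    · rw [lowerSum_right x y (m - 1) (by omega) (by omega),
        lowerSum_right (x - 1) y (m - 1) (by omega) (by omega)]
      omega

theorem lowerSum_step_y (hh : IsDiagonalHeight n h) (x y : ℤ) (h1 : 0 ≤ x) (h2 : 1 ≤ y)
    (h3 : x + y ≤ 2 * n) : lowerSum n h x (y - 1) ≤ lowerSum n h x y ∧
      lowerSum n h x y ≤ lowerSum n h x (y - 1) + 1 := by
  obtain ⟨m, hm⟩ : ∃ m, x + y = 2 * m ∨ x + y = 2 * m + 1 := ⟨(x + y) / 2, by omega⟩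
  by_cases hxy : x < y - 1
  · rcases hm with hm | hm
    · rw [lowerSum_left x y m (by omega) (by omega),
        lowerSum_left x (y - 1) m (by omega) (by omega)]
      omega
    · have e1 := hh.anti_right (n - x) (n - (m + 1)) (by omega) (by omega) (by omega) (by omega)
      have e2 := hh.le_right (n - x) (n - (m + 1)) (by omega) (by omega) (by omega) (by omega)
      rw [show n - (m + 1) + 1 = n - m by ring] at e1 e2
      rw [lowerSum_left x y (m + 1) (by omega) (by omega),
        lowerSum_left x (y - 1) m (by omega) (by omega)]
      omega
  by_cases hxy' : x = y - 1
  · obtain rfl : m = x := by omega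
    have e1 := hh.anti_right (n - m) (n - y) (by omega) (by omega) (by omega) (by omega)
    have e2 := hh.le_right (n - m) (n - y) (by omega) (by omega) (by omega) (by omega)
    rw [lowerSum_left m y y (by omega) (by omega),
      lowerSum_right m (y - 1) m (by omega) (by omega), show n - (y - 1) = n - y + 1 by ring]
    omega
  · have e1 := hh.anti_right (n - m) (n - y) (by omega) (by omega) (by omega) (by omega)
    have e2 := hh.le_right (n - m) (n - y) (by omega) (by omega) (by omega) (by omega)
    have e3 := hh.anti_left (n - m) (n - y + 1) (by omega)
    have e4 := hh.diag (n - m) (n - y) (by omega)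
    rw [lowerSum_right x y m (by omega) (by omega)]
    rcases hm with hm | hm
    · rw [lowerSum_right x (y - 1) (m - 1) (by omega) (by omega),
        show n - (m - 1) = n - m + 1 by ring, show n - (y - 1) = n - y + 1 by ring]
      have e3 := e3 (by omega) (by omega) (by omega)
      have e4 := e4 (by omega) (by omega) (by omega)
      omega
    · rw [lowerSum_right x (y - 1) m (by omega) (by omega), show n - (y - 1) = n - y + 1 by ring]
      omega

/-- On the antidiagonal one of the arguments of `h` is 0, and `symm` is exactly what lets the two
halves be glued by the half-turn. -/
theorem lowerSum_symm (hh : IsDiagonalHeight n h) (x y : ℤ) (h1 : 0 ≤ x) (h2 : 0 ≤ y)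
    (h3 : x + y = 2 * n) : lowerSum n h x y = lowerSum n h y x := by
  rcases lt_trichotomy x y with hxy | rfl | hxy
  · rw [lowerSum_left x y n hxy (by omega), lowerSum_right y x n (by omega) (by omega), sub_self,
      hh.symm _ (by omega) (by omega)]
  · rfl
  · rw [lowerSum_left y x n hxy (by omega), lowerSum_right x y n (by omega) (by omega), sub_self,
      hh.symm _ (by omega) (by omega)]

theorem isHalfTurnSum_sumOfHeight (hh : IsDiagonalHeight n h) :
    IsHalfTurnSum (2 * n) (sumOfHeight n h) := by
  intro x y h1 h2 h3 h4
  rw [sumOfHeight, sumOfHeight, sub_sub_cancel, sub_sub_cancel]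
  rcases lt_trichotomy (x + y) (2 * n) with h | h | h
  · rw [if_neg (by omega), if_pos (by omega)]
    omega
  · rw [if_pos (by omega), if_pos (by omega), lowerSum_symm hh x y h1 h3 h,
      show 2 * n - x = y by omega, show 2 * n - y = x by omega]
    omega
  · rw [if_pos (by omega), if_neg (by omega)]
    omega

theorem isCornerSum_sumOfHeight (hh : IsDiagonalHeight n h) :
    IsCornerSum (2 * n) (sumOfHeight n h) := by
  have hl : ∀ y, 0 ≤ y → y ≤ 2 * n → lowerSum n h 0 y = 0 := by
    intro y h1 h2
    rcases eq_or_lt_of_le h1 with rfl | h1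
    · rw [lowerSum_right 0 0 0 (by omega) (by omega), sub_zero, hh.zero_left _ (by omega) le_rfl]
    · rw [lowerSum_left 0 y ((y + 1) / 2) h1 (by omega), sub_zero,
        hh.zero_left _ (by omega) (by omega)]
  have hb : ∀ x, 0 ≤ x → x ≤ 2 * n → lowerSum n h x 0 = 0 := by
    intro x h1 h2
    rw [lowerSum_right x 0 (x / 2) h1 (by omega), sub_zero, hh.zero_right _ (by omega) (by omega)]
  have hl' : ∀ y, 0 ≤ y → y ≤ 2 * n → sumOfHeight n h 0 y = 0 := by
    intro y h1 h2
    rw [sumOfHeight, if_pos (by omega), hl y h1 h2]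
  have hb' : ∀ x, 0 ≤ x → x ≤ 2 * n → sumOfHeight n h x 0 = 0 := by
    intro x h1 h2
    rw [sumOfHeight, if_pos (by omega), hb x h1 h2]
  refine ⟨hl', hb', ?_, ?_, ?_, ?_⟩
  · intro y h1 h2
    have := isHalfTurnSum_sumOfHeight hh 0 (2 * n - y) le_rfl (by omega) (by omega) (by omega)
    rw [hl' _ (by omega) (by omega), sub_zero, sub_sub_cancel] at this
    omega
  · intro x h1 h2
    have := isHalfTurnSum_sumOfHeight hh (2 * n - x) 0 (by omega) (by omega) le_rfl (by omega)
    rw [hb' _ (by omega) (by omega), sub_zero, sub_sub_cancel] at this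
    omega
  · intro x y h1 h2 h3 h4
    rw [sumOfHeight, sumOfHeight]
    by_cases hxy : x + y ≤ 2 * n
    · rw [if_pos (by omega), if_pos hxy]
      exact lowerSum_step_x hh x y h1 h3 hxy
    · have := lowerSum_step_x hh (2 * n - x + 1) (2 * n - y) (by omega) (by omega) (by omega)
      rw [add_sub_cancel_right] at this
      rw [if_neg hxy]
      by_cases hxy' : x + y = 2 * n + 1
      · rw [if_pos (by omega), lowerSum_symm hh (x - 1) y (by omega) h3 (by omega)]
        rw [show 2 * n - x + 1 = y by omega, show 2 * n - y = x - 1 by omega] at this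
        rw [show 2 * n - y = x - 1 by omega]
        omega
      · rw [if_neg (by omega), show 2 * n - (x - 1) = 2 * n - x + 1 by ring]
        omega
  · intro x y h1 h2 h3 h4
    rw [sumOfHeight, sumOfHeight]
    by_cases hxy : x + y ≤ 2 * n
    · rw [if_pos (by omega), if_pos hxy]
      exact lowerSum_step_y hh x y h1 h3 hxy
    · have := lowerSum_step_y hh (2 * n - x) (2 * n - y + 1) (by omega) (by omega) (by omega)
      rw [add_sub_cancel_right] at this
      rw [if_neg hxy]
      by_cases hxy' : x + y = 2 * n + 1
      · rw [if_pos (by omega), lowerSum_symm hh x (y - 1) h1 (by omega) (by omega)]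
        rw [show 2 * n - y + 1 = x by omega, show 2 * n - x = y - 1 by omega] at this
        rw [show 2 * n - x = y - 1 by omega]
        omega
      · rw [if_neg (by omega), show 2 * n - (y - 1) = 2 * n - y + 1 by ring]
        omega

theorem isFrozen_sumOfHeight : IsFrozen (2 * n) 0 (sumOfHeight n h) := by
  intro x y h1 h2 h3 h4
  obtain ⟨m, hm⟩ : ∃ m, x + y = 2 * m := ⟨(x + y) / 2, by omega⟩
  rw [sumOfHeight, sumOfHeight, if_pos h3, if_pos (by omega),
    lowerSum_left x y m h2 (by omega), lowerSum_left x (y - 1) m (by omega) (by omega)]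

theorem isFrozen_sumOfHeight_swap : IsFrozen (2 * n) 1 (fun x y => sumOfHeight n h y x) := by
  intro y x h1 h2 h3 h4
  obtain ⟨m, hm⟩ : ∃ m, x + y = 2 * m + 1 := ⟨(x + y) / 2, by omega⟩
  simp only
  rw [sumOfHeight, sumOfHeight, if_pos (by omega), if_pos (by omega),
    lowerSum_right x y m (by omega) (by omega),
    lowerSum_right (x - 1) y m (by omega) (by omega)]

end lowerSum

theorem sumOfHeight_congr {n : ℤ} {h h' : ℤ → ℤ → ℤ}
    (heq : ∀ a b, 0 ≤ a → a ≤ n → 0 ≤ b → b ≤ n → h a b = h' a b) (x y : ℤ) (h1 : 0 ≤ x)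
    (h2 : x ≤ 2 * n) (h3 : 0 ≤ y) (h4 : y ≤ 2 * n) :
    sumOfHeight n h x y = sumOfHeight n h' x y := by
  have key : ∀ x y, 0 ≤ x → 0 ≤ y → x + y ≤ 2 * n → lowerSum n h x y = lowerSum n h' x y := by
    intro x y h1 h2 h3
    unfold lowerSum
    split_ifs <;> exact heq _ _ (by omega) (by omega) (by omega) (by omega)
  unfold sumOfHeight
  split_ifs
  · exact key x y h1 h3 (by omega)
  · rw [key _ _ (by omega) (by omega) (by omega)]

/-! ### From frozen corner sums back to diagonal heights -/

/-- The diagonal heights of a corner-sum function. -/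
def heightOfSum (n : ℤ) (C : ℤ → ℤ → ℤ) (a b : ℤ) : ℤ :=
  if b ≤ a then C (n - a) (n + a - 2 * b) else C (n + b - 2 * a) (n - b)

theorem heightOfSum_left {n : ℤ} {C : ℤ → ℤ → ℤ} {a b : ℤ} (h : b ≤ a) :
    heightOfSum n C a b = C (n - a) (n + a - 2 * b) := if_pos h

theorem heightOfSum_right {n : ℤ} {C : ℤ → ℤ → ℤ} {a b : ℤ} (h : a ≤ b) :
    heightOfSum n C a b = C (n + b - 2 * a) (n - b) := by
  rcases eq_or_lt_of_le h with rfl | h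
  · rw [heightOfSum, if_pos le_rfl]
    congr 1 <;> ring
  · exact if_neg (by omega)

/-- Each point `(a, b)` samples one face of a frozen pair. Adjacent samples are two ordinary steps
apart, or one ordinary step and a frozen edge; the former gives monotonicity, the latter also the
bound by one. -/
theorem isDiagonalHeight_heightOfSum {n : ℤ} {C : ℤ → ℤ → ℤ} (hC : IsCornerSum (2 * n) C)
    (hT : IsHalfTurnSum (2 * n) C) (hL : IsFrozen (2 * n) 0 C)
    (hB : IsFrozen (2 * n) 1 (fun x y => C y x)) : IsDiagonalHeight n (heightOfSum n C) := by
  have hsymm : ∀ a, 0 ≤ a → a ≤ n → heightOfSum n C a 0 = heightOfSum n C 0 a := by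
    intro a h1 h2
    rw [heightOfSum_left h1, heightOfSum_right h1]
    have := hT (n + a) (n - a) (by omega) (by omega) (by omega) (by omega)
    rw [show 2 * n - (n + a) = n - a by ring, show 2 * n - (n - a) = n + a by ring] at this
    simp only [mul_zero, sub_zero]
    omega
  have hleft : ∀ a b, 0 ≤ a → a < n → 0 ≤ b → b ≤ n →
      heightOfSum n C (a + 1) b ≤ heightOfSum n C a b := by
    intro a b h1 h2 h3 h4
    by_cases hab : b ≤ a
    · rw [heightOfSum_left hab, heightOfSum_left (by omega)]
      have e1 := hL (n - (a + 1)) (n + (a + 1) - 2 * b) (by omega) (by omega) (by omega) (by omega)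
      have e2 := hC.step_x (n - a) (n + a - 2 * b) (by omega) (by omega) (by omega) (by omega)
      rw [show n + (a + 1) - 2 * b - 1 = n + a - 2 * b by ring] at e1
      rw [show n - a - 1 = n - (a + 1) by ring] at e2
      omega
    · rw [heightOfSum_right (by omega), heightOfSum_right (by omega)]
      have e1 := hC.step_x (n + b - 2 * a) (n - b) (by omega) (by omega) (by omega) (by omega)
      have e2 := hC.step_x (n + b - 2 * a - 1) (n - b) (by omega) (by omega) (by omega) (by omega)
      rw [show n + b - 2 * a - 1 - 1 = n + b - 2 * (a + 1) by ring] at e2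
      omega
  refine ⟨hleft, ?_, ?_, hsymm, ?_, ?_⟩
  · intro a b h1 h2 h3 h4
    by_cases hab : b < a
    · rw [heightOfSum_left (by omega), heightOfSum_left (by omega)]
      have e1 := hC.step_y (n - a) (n + a - 2 * b) (by omega) (by omega) (by omega) (by omega)
      have e2 := hC.step_y (n - a) (n + a - 2 * b - 1) (by omega) (by omega) (by omega) (by omega)
      rw [show n + a - 2 * b - 1 - 1 = n + a - 2 * (b + 1) by ring] at e2
      omega
    -- For `a = 0` the edge that would be needed lies beyond the antidiagonal, outside the frozen
    -- triangle; `hsymm` moves the question to `b = 0` in the left triangle.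
    rcases eq_or_lt_of_le h1 with rfl | h1
    · rw [← hsymm _ (by omega) (by omega), ← hsymm _ (by omega) (by omega)]
      exact hleft b 0 h3 h4 le_rfl (by omega)
    · rw [heightOfSum_right (by omega), heightOfSum_right (by omega)]
      have e1 := hB (n - b) (n + (b + 1) - 2 * a) (by omega) (by omega) (by omega) (by omega)
      have e2 := hC.step_y (n + (b + 1) - 2 * a) (n - b) (by omega) (by omega) (by omega) (by omega)
      simp only at e1
      rw [show n + (b + 1) - 2 * a - 1 = n + b - 2 * a by ring] at e1
      rw [show n - b - 1 = n - (b + 1) by ring] at e2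
      omega
  · intro a b h1 h2 h3 h4
    by_cases hab : b < a
    · rw [heightOfSum_left (by omega), heightOfSum_left (by omega)]
      have e1 := hL (n - a) (n + a - 2 * b) (by omega) (by omega) (by omega) (by omega)
      have e2 := hC.step_x (n - a) (n + a - 2 * b - 1) (by omega) (by omega) (by omega) (by omega)
      rw [show n - a - 1 = n - (a + 1) by ring,
        show n + a - 2 * b - 1 = n + (a + 1) - 2 * (b + 1) by ring] at e2
      rw [show n + a - 2 * b - 1 = n + (a + 1) - 2 * (b + 1) by ring] at e1
      omega
    · rw [heightOfSum_right (by omega), heightOfSum_right (by omega)]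
      have e1 := hB (n - b - 1) (n + b - 2 * a) (by omega) (by omega) (by omega) (by omega)
      have e2 := hC.step_y (n + b - 2 * a) (n - b) (by omega) (by omega) (by omega) (by omega)
      simp only at e1
      rw [show n + b - 2 * a - 1 = n + (b + 1) - 2 * (a + 1) by ring] at e1
      rw [show n - (b + 1) = n - b - 1 by ring]
      omega
  · intro b h1 h2
    rw [heightOfSum_left h2, sub_self, hC.left _ (by omega) (by omega)]
  · intro a h1 h2
    rw [heightOfSum_right h2, sub_self, hC.bottom _ (by omega) (by omega)]

theorem sumOfHeight_heightOfSum {n : ℤ} {C : ℤ → ℤ → ℤ}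
    (hT : IsHalfTurnSum (2 * n) C) (hL : IsFrozen (2 * n) 0 C)
    (hB : IsFrozen (2 * n) 1 (fun x y => C y x)) (x y : ℤ) (h1 : 0 ≤ x) (h2 : x ≤ 2 * n)
    (h3 : 0 ≤ y) (h4 : y ≤ 2 * n) : sumOfHeight n (heightOfSum n C) x y = C x y := by
  have key : ∀ x y, 0 ≤ x → 0 ≤ y → x + y ≤ 2 * n → lowerSum n (heightOfSum n C) x y = C x y := by
    intro x y h1 h2 h3
    by_cases hxy : x < y
    · obtain ⟨m, hm⟩ : ∃ m, x + y = 2 * m ∨ x + y = 2 * m - 1 := ⟨(x + y + 1) / 2, by omega⟩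
      rw [lowerSum_left x y m hxy hm, heightOfSum_left (by omega), sub_sub_cancel]
      rcases hm with hm | hm
      · congr 1
        omega
      -- For odd `x + y` the sampled face is `(x, y + 1)`, on the other side of a frozen edge.
      · have e := hL x (y + 1) h1 (by omega) (by omega) (by omega)
        rw [add_sub_cancel_right] at e
        rw [← e]
        congr 1
        omega
    · obtain ⟨m, hm⟩ : ∃ m, x + y = 2 * m ∨ x + y = 2 * m + 1 := ⟨(x + y) / 2, by omega⟩
      rw [lowerSum_right x y m (by omega) hm, heightOfSum_right (by omega), sub_sub_cancel]
      rcases hm with hm | hm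
      · congr 1
        omega
      · have e := hB y x h2 (by omega) (by omega) (by omega)
        simp only at e
        rw [e]
        congr 1
        omega
  rw [sumOfHeight]
  split_ifs with h
  · exact key x y h1 h3 h
  · rw [key _ _ (by omega) (by omega) (by omega), hT x y h1 h2 h3 h4]
    omega

theorem height_eq_of_sumOfHeight_eq {n : ℤ} {h h' : ℤ → ℤ → ℤ}
    (heq : ∀ x y, 0 ≤ x → x ≤ 2 * n → 0 ≤ y → y ≤ 2 * n →
      sumOfHeight n h x y = sumOfHeight n h' x y) (a b : ℤ) (h1 : 0 ≤ a) (h2 : a ≤ n)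
    (h3 : 0 ≤ b) (h4 : b ≤ n) : h a b = h' a b := by
  by_cases hab : b < a
  · have := heq (n - a) (n + a - 2 * b) (by omega) (by omega) (by omega) (by omega)
    rw [sumOfHeight, sumOfHeight, if_pos (by omega), if_pos (by omega),
      lowerSum_left _ _ (n - b) (by omega) (by omega),
      lowerSum_left _ _ (n - b) (by omega) (by omega), sub_sub_cancel, sub_sub_cancel] at this
    exact this
  · have := heq (n + b - 2 * a) (n - b) (by omega) (by omega) (by omega) (by omega)
    rw [sumOfHeight, sumOfHeight, if_pos (by omega), if_pos (by omega),
      lowerSum_right _ _ (n - a) (by omega) (by omega),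
      lowerSum_right _ _ (n - a) (by omega) (by omega), sub_sub_cancel, sub_sub_cancel] at this
    exact this

/-! ### Cyclically symmetric plane partitions and diagonal heights -/

theorem lt_card_filter_range_iff {q : ℕ → Prop} [DecidablePred q] {n : ℕ}
    (hq : ∀ t u, t ≤ u → q u → q t) (hn : ∀ t, q t → t < n) (t : ℕ) :
    t < ((Finset.range n).filter q).card ↔ q t := by
  constructor
  · intro h
    by_contra hqt
    have : (Finset.range n).filter q ⊆ Finset.range t := by
      intro u hu
      rw [Finset.mem_filter] at hu
      rw [Finset.mem_range]
      by_contra htu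
      exact hqt (hq t u (by omega) hu.2)
    have := Finset.card_le_card this
    rw [Finset.card_range] at this
    omega
  · intro h
    have : Finset.range (t + 1) ⊆ (Finset.range n).filter q := by
      intro u hu
      rw [Finset.mem_range] at hu
      have hu' := hq u t (by omega) h
      exact Finset.mem_filter.2 ⟨Finset.mem_range.2 (hn u hu'), hu'⟩
    have := Finset.card_le_card this
    rw [Finset.card_range] at this
    omega

/-- The number of cells `(t, a + t, b + t)` of a plane partition in the `n × n × n` box. -/
noncomputable def PlanePartition.height (P : PlanePartition) (n : ℕ) (a b : ℤ) : ℤ :=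
  ((Finset.range n).filter (fun t => (t, a.toNat + t, b.toNat + t) ∈ P.cells)).card

namespace PlanePartition

variable {P Q : PlanePartition} {n : ℕ}

theorem mem_of_le (P : PlanePartition) {i j k i' j' k' : ℕ} (h : (i, j, k) ∈ P.cells)
    (hi : i' ≤ i) (hj : j' ≤ j) (hk : k' ≤ k) : (i', j', k') ∈ P.cells :=
  P.isLowerSet (a := (i, j, k)) ⟨hi, hj, hk⟩ h

/-- The cells of a diagonal form an initial segment, so their number is also the first missing
index. -/
theorem lt_height_iff (hP : P.FitsInBox n) (a b t : ℕ) :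
    (t : ℤ) < P.height n a b ↔ (t, a + t, b + t) ∈ P.cells := by
  rw [height, Int.toNat_natCast, Int.toNat_natCast, Nat.cast_lt]
  refine lt_card_filter_range_iff (q := fun t => (t, a + t, b + t) ∈ P.cells) ?_ ?_ t
  · intro t u htu h
    exact P.mem_of_le h htu (by omega) (by omega)
  · intro t h
    exact (hP _ _ _ h).1

theorem height_nonneg (a b : ℤ) : 0 ≤ P.height n a b := Int.natCast_nonneg _

theorem isDiagonalHeight_height (hP : P.FitsInBox n) (hS : P.IsCyclicallySymmetric) :
    IsDiagonalHeight n (P.height n) := by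
  -- Inequalities between heights are reduced to implications between memberships of single cells.
  have hle : ∀ (a b a' b' : ℕ) (d : ℤ), 0 ≤ d →
      (∀ t : ℕ, (t : ℤ) + d < P.height n a b → (t : ℤ) < P.height n a' b') →
      P.height n a b ≤ P.height n a' b' + d := by
    intro a b a' b' d hd h
    by_contra hlt
    have h0 := P.height_nonneg (n := n) a' b'
    have := h (P.height n a' b').toNat (by omega)
    omega
  constructor
  · intro a b h1 h2 h3 h4
    lift a to ℕ using h1
    lift b to ℕ using h3
    have := hle (a + 1) b a b 0 le_rfl ?_
    · simpa using this
    · intro t ht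
      rw [add_zero, lt_height_iff hP] at ht
      rw [lt_height_iff hP]
      exact P.mem_of_le ht le_rfl (by omega) le_rfl
  · intro a b h1 h2 h3 h4
    lift a to ℕ using h1
    lift b to ℕ using h3
    have := hle a (b + 1) a b 0 le_rfl ?_
    · simpa using this
    · intro t ht
      rw [add_zero, lt_height_iff hP] at ht
      rw [lt_height_iff hP]
      exact P.mem_of_le ht le_rfl le_rfl (by omega)
  · intro a b h1 h2 h3 h4
    lift a to ℕ using h1
    lift b to ℕ using h3
    have := hle a b (a + 1) (b + 1) 1 (by omega) ?_
    · simpa using this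
    · intro t ht
      have ht : ((t + 1 : ℕ) : ℤ) < P.height n a b := by exact_mod_cast ht
      rw [lt_height_iff hP] at ht ⊢
      -- The cell `(t+1, a+t+1, b+t+1)` dominates `(t, a+1+t, b+1+t)`: this costs one cell.
      exact P.mem_of_le ht (by omega) (by omega) (by omega)
  · intro a h1 h2
    lift a to ℕ using h1
    have key : ∀ t : ℕ, (t : ℤ) < P.height n a 0 ↔ (t : ℤ) < P.height n 0 a := by
      intro t
      have e1 := lt_height_iff hP a 0 t
      have e2 := lt_height_iff hP 0 a t
      rw [Nat.cast_zero, zero_add] at e1 e2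
      rw [e1, e2]
      exact (hS t t (a + t)).symm
    have h1 := P.height_nonneg (n := n) a 0
    have h2 := P.height_nonneg (n := n) 0 a
    have h3 := key (P.height n a 0).toNat
    have h4 := key (P.height n 0 a).toNat
    omega
  · intro b h1 h2
    lift b to ℕ using h1
    have h := P.height_nonneg (n := n) n b
    by_contra hne
    have := (lt_height_iff hP n b 0).1 (by rw [Nat.cast_zero]; omega)
    have := hP _ _ _ this
    omega
  · intro a h1 h2
    lift a to ℕ using h1
    have h := P.height_nonneg (n := n) a n
    by_contra hne
    have := (lt_height_iff hP a n 0).1 (by rw [Nat.cast_zero]; omega)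
    have := hP _ _ _ this
    omega

/-- A rotation brings a least coordinate of a cell to the front, and then the cell lies on a
diagonal `(t, a+t, b+t)` with `a, b ≥ 0`. -/
theorem le_of_height_eq (hP : P.FitsInBox n) (hPS : P.IsCyclicallySymmetric)
    (hQ : Q.FitsInBox n) (hQS : Q.IsCyclicallySymmetric)
    (h : ∀ a b : ℤ, 0 ≤ a → a ≤ n → 0 ≤ b → b ≤ n → P.height n a b = Q.height n a b) :
    P.cells ⊆ Q.cells := by
  have key : ∀ i j k, i ≤ j → i ≤ k → (i, j, k) ∈ P.cells → (i, j, k) ∈ Q.cells := by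
    intro i j k hij hik hm
    have hb := hP _ _ _ hm
    have h1 := lt_height_iff hP (j - i) (k - i) i
    have h2 := lt_height_iff hQ (j - i) (k - i) i
    rw [Nat.sub_add_cancel hij, Nat.sub_add_cancel hik] at h1 h2
    rw [← h2, ← h _ _ (by omega) (by omega) (by omega) (by omega), h1]
    exact hm
  rintro ⟨i, j, k⟩ hm
  by_cases h1 : i ≤ j ∧ i ≤ k
  · exact key i j k h1.1 h1.2 hm
  by_cases h2 : j ≤ k ∧ j ≤ i
  · exact (hQS i j k).2 (key j k i h2.1 h2.2 ((hPS i j k).1 hm))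
  · exact (hQS k i j).1 (key k i j (by omega) (by omega) ((hPS k i j).2 hm))

theorem eq_of_height_eq (hP : P.FitsInBox n) (hPS : P.IsCyclicallySymmetric)
    (hQ : Q.FitsInBox n) (hQS : Q.IsCyclicallySymmetric)
    (h : ∀ a b : ℤ, 0 ≤ a → a ≤ n → 0 ≤ b → b ≤ n → P.height n a b = Q.height n a b) :
    P = Q := by
  have : P.cells = Q.cells := Finset.Subset.antisymm (le_of_height_eq hP hPS hQ hQS h)
    (le_of_height_eq hQ hQS hP hPS fun a b h1 h2 h3 h4 => (h a b h1 h2 h3 h4).symm)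
  cases P
  cases Q
  simp only at this
  subst this
  rfl

end PlanePartition

/-- The cells of the cyclically symmetric plane partition with diagonal heights `h`. -/
def HeightCell (h : ℤ → ℤ → ℤ) (i j k : ℕ) : Prop :=
  (i ≤ j ∧ i ≤ k ∧ (i : ℤ) < h (j - i) (k - i)) ∨
  (j ≤ k ∧ j ≤ i ∧ (j : ℤ) < h (k - j) (i - j)) ∨
  (k ≤ i ∧ k ≤ j ∧ (k : ℤ) < h (i - k) (j - k))

section HeightCell

variable {n : ℕ} {h : ℤ → ℤ → ℤ}

theorem heightCell_rotate {i j k : ℕ} : HeightCell h i j k ↔ HeightCell h j k i := by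
  unfold HeightCell
  tauto

/-- When the least coordinate is attained twice, several clauses of `HeightCell` apply; `symm` shows
that they agree. -/
theorem heightCell_iff (hh : IsDiagonalHeight n h) {i j k : ℕ} (hj : j < n)
    (hk : k < n) (hij : i ≤ j) (hik : i ≤ k) :
    HeightCell h i j k ↔ (i : ℤ) < h (j - i) (k - i) := by
  constructor
  · rintro (⟨-, -, h3⟩ | ⟨h1, h2, h3⟩ | ⟨h1, h2, h3⟩)
    · exact h3
    · obtain rfl : i = j := by omega
      rw [sub_self] at h3 ⊢
      rwa [← hh.symm _ (by omega) (by omega)]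
    · obtain rfl : i = k := by omega
      rw [sub_self] at h3 ⊢
      rwa [hh.symm _ (by omega) (by omega)]
  · exact fun h3 => Or.inl ⟨hij, hik, h3⟩

/-- While the same coordinate stays least, this is `diag` or monotonicity of `h`. Invariance under
rotation then gives closure in all three coordinates. -/
theorem heightCell_of_succ (hh : IsDiagonalHeight n h) {i j k : ℕ} (hi : i + 1 < n) (hj : j < n)
    (hk : k < n) (hc : HeightCell h (i + 1) j k) : HeightCell h i j k := by
  rcases hc with ⟨h1, h2, h3⟩ | ⟨h1, h2, h3⟩ | ⟨h1, h2, h3⟩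
  · rw [heightCell_iff hh hj hk (by omega) (by omega)]
    have := hh.diag (j - (i + 1)) (k - (i + 1)) (by omega) (by omega) (by omega) (by omega)
    rw [show (j : ℤ) - (i + 1) + 1 = j - i by ring, show (k : ℤ) - (i + 1) + 1 = k - i by ring]
      at this
    push_cast at h3
    omega
  · by_cases hji : j ≤ i
    · rw [heightCell_rotate, heightCell_iff hh hk (by omega) h1 hji]
      have := hh.anti_right (k - j) (i - j) (by omega) (by omega) (by omega) (by omega)
      rw [show (i : ℤ) - j + 1 = i + 1 - j by ring] at this
      push_cast at h3
      omega
    -- The first coordinate overtakes `j` as the least one, so `symm` must change the clause before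
    -- `diag` applies.
    · obtain rfl : j = i + 1 := by omega
      rw [heightCell_iff hh hj hk (by omega) (by omega)]
      have := hh.diag 0 (k - (i + 1)) (by omega) (by omega) (by omega) (by omega)
      push_cast at h3 ⊢
      rw [sub_self, hh.symm _ (by omega) (by omega)] at h3
      rw [show (k : ℤ) - (i + 1) + 1 = k - i by ring] at this
      rw [show (i : ℤ) + 1 - i = 0 + 1 by ring]
      omega
  · by_cases hki : k ≤ i
    · rw [heightCell_rotate, heightCell_rotate, heightCell_iff hh (by omega) hj hki h2]
      have := hh.anti_left (i - k) (j - k) (by omega) (by omega) (by omega) (by omega)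
      rw [show (i : ℤ) - k + 1 = i + 1 - k by ring] at this
      push_cast at h3
      omega
    · obtain rfl : k = i + 1 := by omega
      rw [heightCell_iff hh hj hk (by omega) (by omega)]
      have := hh.diag (j - (i + 1)) 0 (by omega) (by omega) (by omega) (by omega)
      push_cast at h3 ⊢
      rw [sub_self, ← hh.symm _ (by omega) (by omega)] at h3
      rw [show (j : ℤ) - (i + 1) + 1 = j - i by ring] at this
      rw [show (i : ℤ) + 1 - i = 0 + 1 by ring]
      omega

theorem heightCell_of_le (hh : IsDiagonalHeight n h) {i i' j k : ℕ} (hi : i < n) (hj : j < n)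
    (hk : k < n) (hii : i' ≤ i) (hc : HeightCell h i j k) : HeightCell h i' j k := by
  induction i, hii using Nat.le_induction with
  | base => exact hc
  | succ i _ ih => exact ih (by omega) (heightCell_of_succ hh hi hj hk hc)

open Classical in
/-- The cyclically symmetric plane partition with given diagonal heights. -/
noncomputable def IsDiagonalHeight.toPlanePartition (hh : IsDiagonalHeight n h) :
    PlanePartition where
  cells := (Finset.range n ×ˢ (Finset.range n ×ˢ Finset.range n)).filter
    (fun v => HeightCell h v.1 v.2.1 v.2.2)
  isLowerSet := by
    rintro ⟨i, j, k⟩ ⟨i', j', k'⟩ ⟨h1, h2, h3⟩ hm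
    simp only [Finset.coe_filter, Finset.mem_product, Finset.mem_range, Set.mem_ofPred_eq]
      at hm h1 h2 h3 ⊢
    obtain ⟨⟨hi, hj, hk⟩, hc⟩ := hm
    refine ⟨by omega, ?_⟩
    have c1 := heightCell_rotate.1 (heightCell_of_le hh hi hj hk h1 hc)
    have c2 := heightCell_rotate.1 (heightCell_of_le hh hj hk (by omega) h2 c1)
    exact heightCell_rotate.1 (heightCell_of_le hh hk (by omega) (by omega) h3 c2)

theorem IsDiagonalHeight.mem_toPlanePartition (hh : IsDiagonalHeight n h) (i j k : ℕ) :
    (i, j, k) ∈ hh.toPlanePartition.cells ↔ (i < n ∧ j < n ∧ k < n) ∧ HeightCell h i j k := by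
  simp [toPlanePartition]

theorem IsDiagonalHeight.fitsInBox_toPlanePartition (hh : IsDiagonalHeight n h) :
    hh.toPlanePartition.FitsInBox n := fun i j k hm => ((hh.mem_toPlanePartition i j k).1 hm).1

theorem IsDiagonalHeight.isCyclicallySymmetric_toPlanePartition (hh : IsDiagonalHeight n h) :
    hh.toPlanePartition.IsCyclicallySymmetric := by
  intro i j k
  rw [hh.mem_toPlanePartition, hh.mem_toPlanePartition, heightCell_rotate]
  tauto

/-- The bounds `h a b ≤ n - a` and `h a b ≤ n - b` ensure that cutting down to the box removes no
cell of the diagonal. -/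
theorem IsDiagonalHeight.height_toPlanePartition (hh : IsDiagonalHeight n h) (a b : ℤ)
    (h1 : 0 ≤ a) (h2 : a ≤ n) (h3 : 0 ≤ b) (h4 : b ≤ n) :
    hh.toPlanePartition.height n a b = h a b := by
  lift a to ℕ using h1
  lift b to ℕ using h3
  have key : ∀ t : ℕ, (t : ℤ) < hh.toPlanePartition.height n a b ↔ (t : ℤ) < h a b := by
    intro t
    rw [PlanePartition.lt_height_iff hh.fitsInBox_toPlanePartition, hh.mem_toPlanePartition]
    have e1 := hh.le_sub_left a b (by omega) h2 (by omega) h4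
    have e2 := hh.le_sub_right a b (by omega) h2 (by omega) h4
    have e3 : a + t < n → b + t < n → (HeightCell h t (a + t) (b + t) ↔ (t : ℤ) < h a b) := by
      intro h5 h6
      rw [heightCell_iff hh h5 h6 (by omega) (by omega)]
      push_cast
      rw [add_sub_cancel_right, add_sub_cancel_right]
    constructor
    · rintro ⟨⟨-, h5, h6⟩, h7⟩
      exact (e3 h5 h6).1 h7
    · intro h5
      exact ⟨by omega, (e3 (by omega) (by omega)).2 h5⟩
  have k1 := hh.toPlanePartition.height_nonneg (n := n) a b
  have k2 := hh.nonneg a b (by omega) h2 (by omega) h4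
  have k3 := key (hh.toPlanePartition.height n a b).toNat
  have k4 := key (h a b).toNat
  omega

end HeightCell

/-! ### Transposition -/

theorem IsCornerSum.swap {N : ℤ} {C : ℤ → ℤ → ℤ} (h : IsCornerSum N C) :
    IsCornerSum N (fun x y => C y x) :=
  ⟨h.bottom, h.left, h.top, h.right, fun x y h1 h2 h3 h4 => h.step_y y x h3 h4 h1 h2,
    fun x y h1 h2 h3 h4 => h.step_x y x h3 h4 h1 h2⟩

/-- Vertical edges follow the opposite parity convention, so transposition turns `p = 0` into `p =
1`. -/
theorem Encodes.swap {N : ℤ} {C : ℤ → ℤ → ℤ} {G : SimpleGraph (ℤ × ℤ)} (h : Encodes N 0 C G) :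
    Encodes N 1 (fun x y => C y x) (G.comap Prod.swap) where
  horiz x y h1 h2 h3 h4 := by
    rw [SimpleGraph.comap_adj, Prod.swap_prod_mk, Prod.swap_prod_mk, h.vert y x h3 h4 h1 h2]
    omega
  vert x y h1 h2 h3 h4 := by
    rw [SimpleGraph.comap_adj, Prod.swap_prod_mk, Prod.swap_prod_mk, h.horiz y x h3 h4 h1 h2]
    omega

/-! ### Fixed edges in the left triangle -/

section Triangle

variable {N p : ℤ} {C : ℤ → ℤ → ℤ} {G : SimpleGraph (ℤ × ℤ)}

/-- A path that leaves a frozen region through one of the three directions other than the right one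
arrives at the left border. -/
theorem exists_reachable_left (hC : IsCornerSum N C) (hG : Encodes N p C G) {X : ℤ}
    (hF : ∀ x y, 0 ≤ x → x < X → x < y → x + y ≤ N → (x + y + p) % 2 = 0 → C x y = C x (y - 1)) :
    ∀ x y, 0 ≤ x → x < X → x < y → x + y ≤ N → (x + y + p) % 2 = 0 →
      1 ≤ y + 2 * C x y - x ∧ y + 2 * C x y - x ≤ N ∧
        G.Reachable (x, y) (0, y + 2 * C x y - x) := by
  intro x
  induction hx : x.toNat using Nat.strong_induction_on generalizing x with
  | _ k ih =>
  intro y h1 h2 h3 h4 h5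
  rcases eq_or_lt_of_le h1 with rfl | h1'
  · rw [hC.left y (by omega) (by omega), mul_zero, add_zero, sub_zero]
    exact ⟨by omega, by omega, SimpleGraph.Reachable.refl _⟩
  have f0 := hF x y h1 h2 h3 h4 h5
  have sy := hC.step_y (x - 1) y (by omega) (by omega) (by omega) (by omega)
  have sx := hC.step_x x y (by omega) (by omega) (by omega) (by omega)
  have sx' := hC.step_x x (y - 1) (by omega) (by omega) (by omega) (by omega)
  have fix : ∀ x' y', x' < x → 0 ≤ x' → x' < y' → x' + y' ≤ N → (x' + y' + p) % 2 = 0 →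
      G.Adj (x', y') (x' + 1, y') := by
    intro x' y' h6 h7 h8 h9 h10
    rw [hG.horiz x' y' h7 (by omega) (by omega) (by omega)]
    exact iff_of_true (hF x' y' h7 (by omega) h8 h9 h10) h10
  -- The three cases are a path continuing downwards, upwards or to the left. In each, the next
  -- vertex is the right end of a fixed edge, whose left end has the same value of `y + 2 * C x y -
  -- x`.
  rcases eq_or_lt_of_le sx'.1 with hd | hd
  · have e1 := hG.vert x (y - 1) (by omega) (by omega) (by omega) (by omega)
    have e2 := fix (x - 1) (y - 1) (by omega) (by omega) (by omega) (by omega) (by omega)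
    rw [sub_add_cancel] at e1 e2
    have e1 := e1.2 (by omega)
    have f1 := hF (x - 1) (y - 1) (by omega) (by omega) (by omega) (by omega) (by omega)
    have r := ih (x - 1).toNat (by omega) (x - 1) rfl (y - 1) (by omega) (by omega) (by omega)
      (by omega) (by omega)
    rw [show y - 1 + 2 * C (x - 1) (y - 1) - (x - 1) = y + 2 * C x y - x by omega] at r
    exact ⟨r.1, r.2.1, e1.symm.reachable.trans (e2.symm.reachable.trans r.2.2)⟩
  rcases eq_or_lt_of_le sy.1 with hu | hu
  · have e1 := (hG.vert x y (by omega) (by omega) (by omega) (by omega)).2 (by omega)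
    have e2 := fix (x - 1) (y + 1) (by omega) (by omega) (by omega) (by omega) (by omega)
    rw [sub_add_cancel] at e2
    have f1 := hF (x - 1) (y + 1) (by omega) (by omega) (by omega) (by omega) (by omega)
    rw [add_sub_cancel_right] at f1
    have r := ih (x - 1).toNat (by omega) (x - 1) rfl (y + 1) (by omega) (by omega) (by omega)
      (by omega) (by omega)
    rw [show y + 1 + 2 * C (x - 1) (y + 1) - (x - 1) = y + 2 * C x y - x by omega] at r
    exact ⟨r.1, r.2.1, e1.reachable.trans (e2.symm.reachable.trans r.2.2)⟩
  · have hx2 : 2 ≤ x := by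
      by_contra hx2
      obtain rfl : x = 1 := by omega
      rw [sub_self, hC.left _ (by omega) (by omega), hC.left _ (by omega) (by omega)] at hu
      omega
    have e1 := hG.horiz (x - 1) y (by omega) (by omega) (by omega) (by omega)
    have e2 := fix (x - 2) y (by omega) (by omega) (by omega) (by omega) (by omega)
    rw [sub_add_cancel] at e1
    rw [show x - 2 + 1 = x - 1 by ring] at e2
    have e1 := e1.2 (by omega)
    have f1 := hF (x - 2) y (by omega) (by omega) (by omega) (by omega) (by omega)
    have s1 := hC.step_x (x - 1) y (by omega) (by omega) (by omega) (by omega)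
    have s2 := hC.step_x (x - 1) (y - 1) (by omega) (by omega) (by omega) (by omega)
    rw [show x - 1 - 1 = x - 2 by ring] at s1 s2
    have r := ih (x - 2).toNat (by omega) (x - 2) rfl y (by omega) (by omega) (by omega)
      (by omega) (by omega)
    rw [show y + 2 * C (x - 2) y - (x - 2) = y + 2 * C x y - x by omega] at r
    exact ⟨r.1, r.2.1, e1.symm.reachable.trans (e2.symm.reachable.trans r.2.2)⟩

/-- If no two endpoints of the left border are joined, the left triangle is frozen. -/
theorem isFrozen_of_not_reachable (hC : IsCornerSum N C) (hG : Encodes N p C G)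
    (hR : ∀ y y', 1 ≤ y → y ≤ N → 1 ≤ y' → y' ≤ N → (y + p) % 2 = 0 → (y' + p) % 2 = 0 →
      y ≠ y' → ¬ G.Reachable (0, y) (0, y')) : IsFrozen N p C := by
  intro x
  induction hx : x.toNat using Nat.strong_induction_on generalizing x with
  | _ k ih =>
  intro y h1 h2 h3 h4
  rcases eq_or_lt_of_le h1 with rfl | h1'
  · rw [hC.left y (by omega) (by omega), hC.left _ (by omega) (by omega)]
  have hF : ∀ x' y', 0 ≤ x' → x' < x → x' < y' → x' + y' ≤ N → (x' + y' + p) % 2 = 0 →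
      C x' y' = C x' (y' - 1) := fun x' y' h6 h7 =>
    ih x'.toNat (by omega) x' rfl y' h6
  have reach := exists_reachable_left hC hG hF
  have fix : ∀ x' y', x' < x → 0 ≤ x' → x' < y' → x' + y' ≤ N → (x' + y' + p) % 2 = 0 →
      G.Adj (x', y') (x' + 1, y') := by
    intro x' y' h6 h7 h8 h9 h10
    rw [hG.horiz x' y' h7 (by omega) (by omega) (by omega)]
    exact iff_of_true (hF x' y' h7 (by omega) h8 h9 h10) h10
  -- If the edge to the right is absent, two of the other three edges at `(x, y)` are present, and
  -- both lead to the left border.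
  by_contra hne
  have syx := hC.step_y x y (by omega) (by omega) (by omega) (by omega)
  have sy := hC.step_y (x - 1) y (by omega) (by omega) (by omega) (by omega)
  have sx := hC.step_x x y (by omega) (by omega) (by omega) (by omega)
  have sx' := hC.step_x x (y - 1) (by omega) (by omega) (by omega) (by omega)
  have join : ∀ a b, G.Reachable (x, y) (0, a) → G.Reachable (x, y) (0, b) → 1 ≤ a → a ≤ N →
      1 ≤ b → b ≤ N → (a + p) % 2 = 0 → (b + p) % 2 = 0 → a = b := by
    intro a b ha hb h5 h6 h7 h8 h9 h10
    by_contra hab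
    exact hR a b h5 h6 h7 h8 h9 h10 hab (ha.symm.trans hb)
  have left : C (x - 1) y ≠ C (x - 1) (y - 1) → 2 ≤ x ∧
      (1 ≤ y + 2 * C (x - 2) y - (x - 2) ∧ y + 2 * C (x - 2) y - (x - 2) ≤ N ∧
        G.Reachable (x, y) (0, y + 2 * C (x - 2) y - (x - 2))) := by
    intro h
    have hx2 : 2 ≤ x := by
      by_contra hx2
      obtain rfl : x = 1 := by omega
      rw [sub_self, hC.left _ (by omega) (by omega), hC.left _ (by omega) (by omega)] at h
      exact h rfl
    have e1 := hG.horiz (x - 1) y (by omega) (by omega) (by omega) (by omega)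
    have e2 := fix (x - 2) y (by omega) (by omega) (by omega) (by omega) (by omega)
    rw [sub_add_cancel] at e1
    rw [show x - 2 + 1 = x - 1 by ring] at e2
    have e1 := e1.2 (by omega)
    have r := reach (x - 2) y (by omega) (by omega) (by omega) (by omega) (by omega)
    exact ⟨hx2, r.1, r.2.1, e1.symm.reachable.trans (e2.symm.reachable.trans r.2.2)⟩
  have up : C x y ≠ C (x - 1) y →
      (1 ≤ y + 1 + 2 * C (x - 1) (y + 1) - (x - 1) ∧ y + 1 + 2 * C (x - 1) (y + 1) - (x - 1) ≤ N ∧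
        G.Reachable (x, y) (0, y + 1 + 2 * C (x - 1) (y + 1) - (x - 1))) := by
    intro h
    have e1 := (hG.vert x y (by omega) (by omega) (by omega) (by omega)).2 (by omega)
    have e2 := fix (x - 1) (y + 1) (by omega) (by omega) (by omega) (by omega) (by omega)
    rw [sub_add_cancel] at e2
    have r := reach (x - 1) (y + 1) (by omega) (by omega) (by omega) (by omega) (by omega)
    exact ⟨r.1, r.2.1, e1.reachable.trans (e2.symm.reachable.trans r.2.2)⟩
  have down : C x (y - 1) = C (x - 1) (y - 1) →
      (1 ≤ y - 1 + 2 * C (x - 1) (y - 1) - (x - 1) ∧ y - 1 + 2 * C (x - 1) (y - 1) - (x - 1) ≤ N ∧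
        G.Reachable (x, y) (0, y - 1 + 2 * C (x - 1) (y - 1) - (x - 1))) := by
    intro h
    have e1 := hG.vert x (y - 1) (by omega) (by omega) (by omega) (by omega)
    have e2 := fix (x - 1) (y - 1) (by omega) (by omega) (by omega) (by omega) (by omega)
    rw [sub_add_cancel] at e1 e2
    have e1 := e1.2 (by omega)
    have r := reach (x - 1) (y - 1) (by omega) (by omega) (by omega) (by omega) (by omega)
    exact ⟨r.1, r.2.1, e1.symm.reachable.trans (e2.symm.reachable.trans r.2.2)⟩
  have f1 := hF (x - 1) (y + 1) (by omega) (by omega) (by omega) (by omega) (by omega)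
  rw [add_sub_cancel_right] at f1
  have left' : C (x - 1) y ≠ C (x - 1) (y - 1) →
      C (x - 2) y ≤ C (x - 1) y ∧ C (x - 1) y ≤ C (x - 2) y + 1 ∧
      C (x - 2) (y - 1) ≤ C (x - 1) (y - 1) ∧ C (x - 1) (y - 1) ≤ C (x - 2) (y - 1) + 1 ∧
      C (x - 2) y = C (x - 2) (y - 1) := by
    intro h
    have hx2 := (left h).1
    have s1 := hC.step_x (x - 1) y (by omega) (by omega) (by omega) (by omega)
    have s2 := hC.step_x (x - 1) (y - 1) (by omega) (by omega) (by omega) (by omega)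
    rw [show x - 1 - 1 = x - 2 by ring] at s1 s2
    exact ⟨s1.1, s1.2, s2.1, s2.2, hF (x - 2) y (by omega) (by omega) (by omega) (by omega)
      (by omega)⟩
  -- The rows reached downwards, to the left and upwards are strictly increasing, so two of them
  -- joined together contradict `hR`.
  by_cases c1 : C (x - 1) y = C (x - 1) (y - 1)
  · have u := up (by omega)
    have d := down (by omega)
    have := join _ _ u.2.2 d.2.2 (by omega) (by omega) (by omega) (by omega) (by omega) (by omega)
    omega
  · have l := left c1
    have l' := left' c1
    by_cases c2 : C x y = C (x - 1) y
    · have d := down (by omega)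
      have := join _ _ l.2.2.2 d.2.2 (by omega) (by omega) (by omega) (by omega) (by omega)
        (by omega)
      omega
    · have u := up c2
      have := join _ _ l.2.2.2 u.2.2 (by omega) (by omega) (by omega) (by omega) (by omega)
        (by omega)
      omega

/-- The row of the endpoint on the left border to which the vertex `(x, y)` of the frozen left
triangle is joined. -/
def row (p : ℤ) (C : ℤ → ℤ → ℤ) (x y : ℤ) : ℤ :=
  if (x + y + p) % 2 = 0 then y + 2 * C x y - x else y + 2 * C (x - 1) y - x + 1

/-- The vertices of the left triangle. -/
def InTriangle (N p x y : ℤ) : Prop :=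
  if (x + y + p) % 2 = 0 then x < y ∧ x + y ≤ N else x ≤ y ∧ x + y ≤ N + 1

/-- Along a fixed edge, `row` at the right end is by definition the value at the left end. Any other
horizontal edge lies between two fixed ones, and its presence forces `C (x + 1) y = C (x - 1) y +
1`. -/
theorem row_horiz (hC : IsCornerSum N C) (hG : Encodes N p C G) (hF : IsFrozen N p C) {x y : ℤ}
    (h1 : 0 ≤ x) (h2 : x ≤ N) (h3 : 1 ≤ y) (h4 : y ≤ N) (hl : InTriangle N p x y)
    (hr : InTriangle N p (x + 1) y) (hadj : G.Adj (x, y) (x + 1, y)) :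
    row p C x y = row p C (x + 1) y := by
  unfold row InTriangle at *
  rcases Int.emod_two_eq_zero_or_one (x + y + p) with h | h
  · rw [if_pos h] at hl ⊢
    rw [if_neg (by omega)] at hr ⊢
    rw [add_sub_cancel_right]
    ring
  · rw [if_neg (by omega)] at hl ⊢
    rw [if_pos (by omega)] at hr ⊢
    rw [hG.horiz x y h1 h2 h3 h4] at hadj
    rcases eq_or_lt_of_le h1 with rfl | h1'
    · rw [hC.left _ (by omega) (by omega), hC.left _ (by omega) (by omega)] at hadj
      omega
    have e1 := hF (x - 1) y (by omega) (by omega) (by omega) (by omega)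
    have e2 := hF (x + 1) y (by omega) (by omega) (by omega) (by omega)
    have s1 := hC.step_x x y (by omega) (by omega) (by omega) (by omega)
    have s2 := hC.step_x x (y - 1) (by omega) (by omega) (by omega) (by omega)
    have s3 := hC.step_x (x + 1) y (by omega) (by omega) (by omega) (by omega)
    have s4 := hC.step_x (x + 1) (y - 1) (by omega) (by omega) (by omega) (by omega)
    have s5 := hC.step_y x y (by omega) (by omega) (by omega) (by omega)
    rw [add_sub_cancel_right] at s3 s4
    omega

theorem row_vert (hC : IsCornerSum N C) (hG : Encodes N p C G) (hF : IsFrozen N p C) {x y : ℤ}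
    (h1 : 1 ≤ x) (h2 : x ≤ N) (h3 : 0 ≤ y) (h4 : y ≤ N) (hl : InTriangle N p x y)
    (hr : InTriangle N p x (y + 1)) (hadj : G.Adj (x, y) (x, y + 1)) :
    row p C x y = row p C x (y + 1) := by
  unfold row InTriangle at *
  have s1 := hC.step_x x y (by omega) (by omega) (by omega) (by omega)
  rw [hG.vert x y h1 h2 h3 h4] at hadj
  rcases Int.emod_two_eq_zero_or_one (x + y + p) with h | h
  · rw [if_pos h] at hl ⊢
    rw [if_neg (by omega)] at hr ⊢
    have e1 := hF (x - 1) (y + 1) (by omega) (by omega) (by omega) (by omega)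
    rw [add_sub_cancel_right] at e1
    omega
  · rw [if_neg (by omega)] at hl ⊢
    rw [if_pos (by omega)] at hr ⊢
    have e1 := hF x (y + 1) (by omega) (by omega) (by omega) (by omega)
    rw [add_sub_cancel_right] at e1
    omega

end Triangle

/-! ### Paths of a half-turn symmetric configuration with frozen triangles -/

/-- The properties of the corner sums of the half-turn symmetric configurations in which no path
joins two endpoints of the same side. -/
structure IsFrozenSum (n : ℤ) (C : ℤ → ℤ → ℤ) : Prop where
  isCornerSum : IsCornerSum (2 * n) C
  isHalfTurnSum : IsHalfTurnSum (2 * n) C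
  left : IsFrozen (2 * n) 0 C
  bottom : IsFrozen (2 * n) 1 (fun x y => C y x)

/-- The positive number `k` with a sign that tells whether `k ≤ 2 * K`. -/
def signed (K k : ℤ) : ℤ := if k ≤ 2 * K then k else -k

/-- An invariant of the paths, on the vertices of the left and bottom triangles. -/
def lowerClass (n : ℤ) (C : ℤ → ℤ → ℤ) (x y : ℤ) : ℤ :=
  if x < y then row 0 C x y else signed (C n n) (row 1 (fun x y => C y x) y x + 1)

/-- The vertices of the left and bottom triangles. -/
def InLower (n x y : ℤ) : Prop := (x < y ∧ x + y ≤ 2 * n + 1) ∨ (y ≤ x ∧ x + y ≤ 2 * n)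

open Classical in
/-- An invariant of the paths. -/
noncomputable def pathClass (n : ℤ) (C : ℤ → ℤ → ℤ) (v : ℤ × ℤ) : ℤ :=
  if InLower n v.1 v.2 then lowerClass n C v.1 v.2
  else -lowerClass n C (2 * n + 1 - v.1) (2 * n + 1 - v.2)

section Paths

variable {n : ℤ} {C : ℤ → ℤ → ℤ} {G : SimpleGraph (ℤ × ℤ)}

theorem IsFrozenSum.diag_le (hC : IsFrozenSum n C) (x : ℤ) (h1 : 0 ≤ x) (h2 : x ≤ n) :
    C x x ≤ C n n := by
  induction x, h2 using Int.leInductionDown with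
  | base => exact le_rfl
  | pred x h2 ih =>
    have s1 := hC.isCornerSum.step_x x x (by omega) (by omega) (by omega) (by omega)
    have s2 := hC.isCornerSum.step_y (x - 1) x (by omega) (by omega) (by omega) (by omega)
    linarith [ih (by omega)]

/-- Going outwards along the antidiagonal, `C` drops by at most one per step while `n - x` grows by
one. -/
theorem IsFrozenSum.le_antidiag (hC : IsFrozenSum n C) (x : ℤ) (h1 : 0 ≤ x) (h2 : x ≤ n) :
    C n n ≤ C x (2 * n - x) + (n - x) := by
  induction x, h2 using Int.leInductionDown with
  | base => rw [show 2 * n - n = n by ring]; omega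
  | pred x h2 ih =>
    have s1 := hC.isCornerSum.step_x x (2 * n - x) (by omega) (by omega) (by omega) (by omega)
    have s2 := hC.isCornerSum.step_y (x - 1) (2 * n - (x - 1)) (by omega) (by omega) (by omega)
      (by omega)
    rw [show 2 * n - (x - 1) - 1 = 2 * n - x by ring] at s2
    linarith [ih (by omega)]

/-- A path crossing the main diagonal has a row bounded by twice a value of `C` there, hence by `2 *
C n n`. It joins the left row `k` to the bottom column `k - 1`, which explains the shift by one. -/
theorem left_bottom_horiz (hC : IsFrozenSum n C) (hG : Encodes (2 * n) 0 C G) {x : ℤ} (h1 : 0 ≤ x)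
    (h2 : x + 1 ≤ n) (h : G.Adj (x, x + 1) (x + 1, x + 1)) :
    row 0 C x (x + 1) = row 1 (fun x y => C y x) (x + 1) (x + 1) + 1 ∧
      row 0 C x (x + 1) ≤ 2 * C n n := by
  have hS := hC.isCornerSum
  rw [hG.horiz x (x + 1) h1 (by omega) (by omega) (by omega), add_sub_cancel_right] at h
  unfold row
  rw [if_neg (by omega), if_neg (by omega), add_sub_cancel_right]
  simp only
  rcases eq_or_lt_of_le h1 with rfl | h1'
  · rw [hS.left _ (by omega) (by omega), hS.left _ (by omega) (by omega)] at h
    omega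
  have b := hC.bottom x (x + 1) h1 (by omega) (by omega) (by omega)
  have l := hC.left (x - 1) (x + 1) (by omega) (by omega) (by omega) (by omega)
  have s1 := hS.step_x x (x + 1) (by omega) (by omega) (by omega) (by omega)
  have s2 := hS.step_x x x (by omega) (by omega) (by omega) (by omega)
  have s3 := hS.step_x (x + 1) (x + 1) (by omega) (by omega) (by omega) (by omega)
  have s4 := hS.step_y x (x + 1) (by omega) (by omega) (by omega) (by omega)
  have d := hC.diag_le (x + 1) (by omega) h2
  simp only [add_sub_cancel_right] at b l s1 s2 s3 s4
  omega

theorem left_bottom_vert (hC : IsFrozenSum n C) (hG : Encodes (2 * n) 0 C G) {x : ℤ} (h1 : 1 ≤ x)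
    (h2 : x ≤ n) (h : G.Adj (x, x) (x, x + 1)) :
    row 0 C x (x + 1) = row 1 (fun x y => C y x) x x + 1 ∧ row 0 C x (x + 1) ≤ 2 * C n n := by
  have hS := hC.isCornerSum
  rw [hG.vert x x h1 (by omega) (by omega) (by omega)] at h
  unfold row
  rw [if_neg (by omega), if_neg (by omega)]
  simp only
  have b := hC.bottom (x - 1) x (by omega) (by omega) (by omega) (by omega)
  have l := hC.left (x - 1) (x + 1) (by omega) (by omega) (by omega) (by omega)
  have s1 := hS.step_x x x (by omega) (by omega) (by omega) (by omega)
  have s2 := hS.step_y x x (by omega) (by omega) (by omega) (by omega)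
  have s3 := hS.step_y (x - 1) x (by omega) (by omega) (by omega) (by omega)
  have d := hC.diag_le x (by omega) h2
  simp only [add_sub_cancel_right] at b l
  omega

/-- The far end lies in the top triangle and is replaced by its half-turn image `(y - 1, x)` in the
bottom one. By `le_antidiag`, crossing the antidiagonal requires a row above `2 * C n n`. -/
theorem left_top_horiz (hC : IsFrozenSum n C) (hG : Encodes (2 * n) 0 C G) {x y : ℤ} (h1 : 1 ≤ x)
    (h2 : x < y) (h3 : x + y = 2 * n + 1) (h : G.Adj (x, y) (x + 1, y)) :
    row 0 C x y = row 1 (fun x y => C y x) x (y - 1) + 1 ∧ 2 * C n n < row 0 C x y := by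
  have hS := hC.isCornerSum
  rw [hG.horiz x y (by omega) (by omega) (by omega) (by omega)] at h
  unfold row
  rw [if_neg (by omega), if_neg (by omega)]
  simp only
  have l := hC.left (x - 1) y (by omega) (by omega) (by omega) (by omega)
  have s1 := hS.step_x x y (by omega) (by omega) (by omega) (by omega)
  have s2 := hS.step_x x (y - 1) (by omega) (by omega) (by omega) (by omega)
  have s3 := hS.step_y x y (by omega) (by omega) (by omega) (by omega)
  have t := hC.isHalfTurnSum x y (by omega) (by omega) (by omega) (by omega)
  rw [show 2 * n - x = y - 1 by omega, show 2 * n - y = x - 1 by omega] at t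
  have d := hC.le_antidiag x (by omega) (by omega)
  rw [show 2 * n - x = y - 1 by omega] at d
  omega

theorem left_top_vert (hC : IsFrozenSum n C) (hG : Encodes (2 * n) 0 C G) {x y : ℤ} (h1 : 1 ≤ x)
    (h2 : x < y) (h3 : x + y = 2 * n + 1) (h : G.Adj (x, y) (x, y + 1)) :
    row 0 C x y = row 1 (fun x y => C y x) (x - 1) y + 1 ∧ 2 * C n n < row 0 C x y := by
  have hS := hC.isCornerSum
  rw [hG.vert x y (by omega) (by omega) (by omega) (by omega)] at h
  unfold row
  rw [if_neg (by omega), if_neg (by omega)]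
  simp only
  have l := hC.left (x - 1) y (by omega) (by omega) (by omega) (by omega)
  have t := hC.isHalfTurnSum x y (by omega) (by omega) (by omega) (by omega)
  rw [show 2 * n - x = y - 1 by omega, show 2 * n - y = x - 1 by omega] at t
  have t' := hC.isHalfTurnSum (x - 1) y (by omega) (by omega) (by omega) (by omega)
  rw [show 2 * n - (x - 1) = y by omega, show 2 * n - y = x - 1 by omega] at t'
  rcases eq_or_lt_of_le h1 with rfl | h1'
  · rw [sub_self, hS.bottom _ (by omega) (by omega)] at t
    rw [sub_self, hS.left _ (by omega) (by omega)] at h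
    omega
  have b := hC.bottom (x - 2) y (by omega) (by omega) (by omega) (by omega)
  have s1 := hS.step_x x (y - 1) (by omega) (by omega) (by omega) (by omega)
  have s2 := hS.step_y x y (by omega) (by omega) (by omega) (by omega)
  have s3 := hS.step_y (y - 1) (x - 1) (by omega) (by omega) (by omega) (by omega)
  have s4 := hS.step_y y (x - 1) (by omega) (by omega) (by omega) (by omega)
  have d := hC.le_antidiag x (by omega) (by omega)
  rw [show 2 * n - x = y - 1 by omega] at d
  simp only [show x - 1 - 1 = x - 2 by ring] at b s3 s4 ⊢
  omega

theorem inTriangle_left {x y : ℤ} (h1 : x < y) (h2 : x + y ≤ 2 * n + 1) :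
    InTriangle (2 * n) 0 x y := by
  unfold InTriangle
  split_ifs <;> omega

theorem inTriangle_bottom {x y : ℤ} (h1 : y ≤ x) (h2 : x + y ≤ 2 * n) :
    InTriangle (2 * n) 1 y x := by
  unfold InTriangle
  split_ifs <;> omega

theorem lowerClass_horiz (hC : IsFrozenSum n C) (hG : Encodes (2 * n) 0 C G) {x y : ℤ}
    (h1 : 0 ≤ x) (h2 : x ≤ 2 * n) (h3 : 1 ≤ y) (h4 : y ≤ 2 * n) (hl : InLower n x y)
    (hr : InLower n (x + 1) y) (h : G.Adj (x, y) (x + 1, y)) :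
    lowerClass n C x y = lowerClass n C (x + 1) y := by
  unfold lowerClass InLower at *
  rcases lt_trichotomy (x + 1) y with hxy | rfl | hxy
  · rw [if_pos (by omega), if_pos hxy]
    exact row_horiz hC.isCornerSum hG hC.left h1 h2 h3 h4 (inTriangle_left (by omega) (by omega))
      (inTriangle_left (by omega) (by omega)) h
  · have := left_bottom_horiz hC hG h1 (by omega) h
    rw [if_pos (by omega), if_neg (by omega), ← this.1, signed, if_pos this.2]
  · rw [if_neg (by omega), if_neg (by omega), row_vert hC.isCornerSum.swap hG.swap hC.bottom h3 h4
      h1 h2 (inTriangle_bottom (by omega) (by omega)) (inTriangle_bottom (by omega) (by omega)) h]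

theorem lowerClass_vert (hC : IsFrozenSum n C) (hG : Encodes (2 * n) 0 C G) {x y : ℤ}
    (h1 : 1 ≤ x) (h2 : x ≤ 2 * n) (h3 : 0 ≤ y) (h4 : y ≤ 2 * n) (hl : InLower n x y)
    (hr : InLower n x (y + 1)) (h : G.Adj (x, y) (x, y + 1)) :
    lowerClass n C x y = lowerClass n C x (y + 1) := by
  unfold lowerClass InLower at *
  rcases lt_trichotomy x y with hxy | rfl | hxy
  · rw [if_pos hxy, if_pos (by omega)]
    exact row_vert hC.isCornerSum hG hC.left h1 h2 h3 h4 (inTriangle_left (by omega) (by omega))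
      (inTriangle_left (by omega) (by omega)) h
  · have := left_bottom_vert hC hG h1 (by omega) h
    rw [if_neg (by omega), if_pos (by omega), ← this.1, signed, if_pos this.2]
  · rw [if_neg (by omega), if_neg (by omega), row_horiz hC.isCornerSum.swap hG.swap hC.bottom h3
      h4 h1 h2 (inTriangle_bottom (by omega) (by omega)) (inTriangle_bottom (by omega) (by omega)) h]

theorem lowerClass_top_horiz (hC : IsFrozenSum n C) (hG : Encodes (2 * n) 0 C G) {x y : ℤ}
    (h1 : 1 ≤ x) (h2 : x < y) (h3 : x + y = 2 * n + 1) (h : G.Adj (x, y) (x + 1, y)) :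
    lowerClass n C x y = -lowerClass n C (y - 1) x := by
  have := left_top_horiz hC hG h1 h2 h3 h
  rw [lowerClass, lowerClass, if_pos h2, if_neg (by omega), ← this.1, signed, if_neg (by omega),
    neg_neg]

theorem lowerClass_top_vert (hC : IsFrozenSum n C) (hG : Encodes (2 * n) 0 C G) {x y : ℤ}
    (h1 : 1 ≤ x) (h2 : x < y) (h3 : x + y = 2 * n + 1) (h : G.Adj (x, y) (x, y + 1)) :
    lowerClass n C x y = -lowerClass n C y (x - 1) := by
  have := left_top_vert hC hG h1 h2 h3 h
  rw [lowerClass, lowerClass, if_pos h2, if_neg (by omega), ← this.1, signed, if_neg (by omega),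
    neg_neg]

end Paths

/-! ### The path invariant and the coupling it determines -/

variable {n : ℕ} {C : ℤ → ℤ → ℤ} {f : FPL (2 * n)}

/-- Within the lower half the triangle lemmas apply directly, within the upper half after a
half-turn. An edge across the antidiagonal uses the top lemmas; their sign change cancels the one in
`pathClass`. -/
theorem pathClass_eq_of_adj (hC : IsFrozenSum n C) (hG : Encodes (2 * n) 0 C f.graph)
    (hf : f.IsHalfTurnSymmetric) (u v : ℤ × ℤ) (h : f.graph.Adj u v) :
    pathClass n C u = pathClass n C v := by
  revert u v h
  refine f.adj_induction (P := fun u v => pathClass n C u = pathClass n C v)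
    (fun u v h => h.symm) ?_ ?_
  · intro x y h1 h2 h3 h4 h
    push_cast at h2 h4
    have h' := (hf _ _).2 h.symm
    simp only [halfTurn] at h'
    push_cast at h'
    rw [show 2 * (n : ℤ) + 1 - (x + 1) = 2 * n - x by ring,
      show 2 * (n : ℤ) + 1 - x = 2 * n - x + 1 by ring] at h'
    simp only [pathClass]
    by_cases hl : InLower n x y
    · by_cases hr : InLower n (x + 1) y
      · rw [if_pos hl, if_pos hr]
        exact lowerClass_horiz hC hG h1 h2 h3 h4 hl hr h
      · rw [if_pos hl, if_neg hr]
        unfold InLower at hl hr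
        by_cases hxy : x < y
        · rw [lowerClass_top_horiz hC hG (by omega) hxy (by omega) h,
            show 2 * (n : ℤ) + 1 - (x + 1) = y - 1 by omega,
            show 2 * (n : ℤ) + 1 - y = x by omega]
        · rw [show 2 * (n : ℤ) - x = y by omega, show 2 * (n : ℤ) + 1 - y = x + 1 by omega] at h'
          rw [show 2 * (n : ℤ) + 1 - (x + 1) = y by omega,
            show 2 * (n : ℤ) + 1 - y = x + 1 by omega,
            lowerClass_top_horiz hC hG h3 (by omega) (by omega) h', neg_neg, add_sub_cancel_right]
    · have hr : ¬ InLower n (x + 1) y := by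
        unfold InLower at hl ⊢
        omega
      rw [if_neg hl, if_neg hr, show 2 * (n : ℤ) + 1 - (x + 1) = 2 * n - x by ring,
        show 2 * (n : ℤ) + 1 - x = 2 * n - x + 1 by ring, neg_inj]
      unfold InLower at hl hr
      exact (lowerClass_horiz hC hG (by omega) (by omega) (by omega) (by omega)
        (by unfold InLower; omega) (by unfold InLower; omega) h').symm
  · intro x y h1 h2 h3 h4 h
    push_cast at h2 h4
    have h' := (hf _ _).2 h.symm
    simp only [halfTurn] at h'
    push_cast at h'
    rw [show 2 * (n : ℤ) + 1 - (y + 1) = 2 * n - y by ring,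
      show 2 * (n : ℤ) + 1 - y = 2 * n - y + 1 by ring] at h'
    simp only [pathClass]
    by_cases hl : InLower n x y
    · by_cases hr : InLower n x (y + 1)
      · rw [if_pos hl, if_pos hr]
        exact lowerClass_vert hC hG h1 h2 h3 h4 hl hr h
      · rw [if_pos hl, if_neg hr]
        unfold InLower at hl hr
        by_cases hxy : x < y
        · rw [lowerClass_top_vert hC hG (by omega) hxy (by omega) h,
            show 2 * (n : ℤ) + 1 - (y + 1) = x - 1 by omega,
            show 2 * (n : ℤ) + 1 - x = y by omega]
        · rw [show 2 * (n : ℤ) - y = x by omega,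
            show 2 * (n : ℤ) + 1 - x = y + 1 by omega] at h'
          rw [show 2 * (n : ℤ) + 1 - x = y + 1 by omega,
            show 2 * (n : ℤ) + 1 - (y + 1) = x by omega,
            lowerClass_top_vert hC hG (by omega) (by omega) (by omega) h', neg_neg,
            add_sub_cancel_right]
    · have hr : ¬ InLower n x (y + 1) := by
        unfold InLower at hl ⊢
        omega
      rw [if_neg hl, if_neg hr, show 2 * (n : ℤ) + 1 - (y + 1) = 2 * n - y by ring,
        show 2 * (n : ℤ) + 1 - y = 2 * n - y + 1 by ring, neg_inj]
      unfold InLower at hl hr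
      exact (lowerClass_vert hC hG (by omega) (by omega) (by omega) (by omega)
        (by unfold InLower; omega) (by unfold InLower; omega) h').symm

theorem pathClass_eq_of_reachable (hC : IsFrozenSum n C) (hG : Encodes (2 * n) 0 C f.graph)
    (hf : f.IsHalfTurnSymmetric) {u v : ℤ × ℤ} (h : f.graph.Reachable u v) :
    pathClass n C u = pathClass n C v := by
  obtain ⟨w⟩ := h
  induction w with
  | nil => rfl
  | cons hadj _ ih => exact (pathClass_eq_of_adj hC hG hf _ _ hadj).trans ih

theorem lowerClass_left (hC : IsFrozenSum n C) (y : ℤ) (h1 : 1 ≤ y) (h2 : y ≤ 2 * n)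
    (h3 : y % 2 = 0) : lowerClass n C 0 y = y := by
  rw [lowerClass, if_pos (by omega), row, if_pos (by omega),
    hC.isCornerSum.left y (by omega) (by omega)]
  ring

theorem lowerClass_bottom (hC : IsFrozenSum n C) (x : ℤ) (h1 : 1 ≤ x) (h2 : x ≤ 2 * n)
    (h3 : x % 2 = 1) : lowerClass n C x 0 = signed (C n n) (x + 1) := by
  rw [lowerClass, if_neg (by omega), row, if_pos (by omega),
    hC.isCornerSum.bottom x (by omega) (by omega)]
  congr 1
  ring

theorem pathClass_of_inLower {n : ℤ} {x y : ℤ} (h : InLower n x y) :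
    pathClass n C (x, y) = lowerClass n C x y := if_pos h

theorem pathClass_of_not_inLower {n : ℤ} {x y : ℤ} (h : ¬ InLower n x y) :
    pathClass n C (x, y) = -lowerClass n C (2 * n + 1 - x) (2 * n + 1 - y) := if_neg h

theorem pathClass_endpoint (hC : IsFrozenSum n C) (i : ℕ) (h1 : 1 ≤ i) (h2 : i ≤ 4 * n) :
    pathClass n C (endpoint (2 * n) i) =
      if i ≤ n then 2 * (n : ℤ) + 2 - 2 * i
      else if i ≤ 2 * n then signed (C n n) (2 * i - 2 * n)
      else if i ≤ 3 * n then -(6 * (n : ℤ) + 2 - 2 * i)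
      else -signed (C n n) (2 * i - 6 * n) := by
  rw [endpoint, outerVertex]
  by_cases a1 : i ≤ n
  · rw [if_pos (by omega), if_pos a1, pathClass_of_inLower (Or.inl (by omega)),
      lowerClass_left hC _ (by omega) (by omega) (by omega)]
    omega
  rw [if_neg (by omega), if_neg a1]
  by_cases a2 : i ≤ 2 * n
  · rw [if_pos (by omega), if_pos a2, pathClass_of_inLower (Or.inr (by omega)),
      lowerClass_bottom hC _ (by omega) (by omega) (by omega)]
    congr 1
    omega
  rw [if_neg (by omega), if_neg a2]
  by_cases a3 : i ≤ 3 * n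
  · rw [if_pos (by omega), if_pos a3, pathClass_of_not_inLower (by unfold InLower; omega),
      show 2 * (n : ℤ) + 1 - (((2 * n : ℕ) : ℤ) + 1) = 0 by omega,
      lowerClass_left hC _ (by omega) (by omega) (by omega)]
    omega
  · rw [if_neg (by omega), if_neg a3, pathClass_of_not_inLower (by unfold InLower; omega),
      show 2 * (n : ℤ) + 1 - (((2 * n : ℕ) : ℤ) + 1) = 0 by omega,
      lowerClass_bottom hC _ (by omega) (by omega) (by omega)]
    congr 2
    omega

/-- Two endpoints with the same invariant form a pair of the coupling `puncturedRarest k n`. -/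
theorem mem_puncturedRarest_of_reachable (hC : IsFrozenSum n C)
    (hG : Encodes (2 * n) 0 C f.graph) (hf : f.IsHalfTurnSymmetric) {k : ℕ}
    (hk : (k : ℤ) = n - C n n) {i j : ℕ} (h1 : 1 ≤ i) (h2 : i ≤ 4 * n) (h3 : 1 ≤ j)
    (h4 : j ≤ 4 * n) (hij : i ≠ j)
    (h : f.graph.Reachable (endpoint (2 * n) i) (endpoint (2 * n) j)) :
    s(i, j) ∈ puncturedRarest k n := by
  have hd := hC.diag_le 0 le_rfl (by omega)
  rw [hC.isCornerSum.left 0 le_rfl (by omega)] at hd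
  have := pathClass_eq_of_reachable hC hG hf h
  rw [pathClass_endpoint hC i h1 h2, pathClass_endpoint hC j h3 h4] at this
  rw [mem_puncturedRarest (by omega)]
  -- Each value belongs to two endpoints: left and bottom for `0 < v ≤ 2 * C n n`, left and top for
  -- larger `v`, and the half-turn images for negative `v`.
  unfold signed at this
  split_ifs at this <;> omega

/-- In a graph with finitely many non-isolated vertices, each vertex of odd degree is joined to
another one. -/
theorem exists_reachable_odd {V : Type*} (G : SimpleGraph V) (S : Finset V)
    (hS : ∀ u v, G.Adj u v → u ∈ S) (v : V) (hv : Odd (G.neighborSet v).ncard) :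
    ∃ w, w ≠ v ∧ G.Reachable v w ∧ Odd (G.neighborSet w).ncard := by
  classical
  -- The component of `v`, with all other vertices of `S` isolated: the handshake lemma needs a
  -- finite graph.
  let H : SimpleGraph S :=
    { Adj := fun a b => G.Adj a b ∧ G.Reachable v a
      symm := ⟨fun a b h => ⟨h.1.symm, h.2.trans h.1.reachable⟩⟩
      loopless := ⟨fun a h => G.loopless.irrefl a h.1⟩ }
  have hdeg : ∀ a : S, H.degree a = if G.Reachable v a then (G.neighborSet a).ncard else 0 := by
    intro a
    rw [← SimpleGraph.card_neighborSet_eq_degree, ← Nat.card_eq_fintype_card,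
      Nat.card_coe_set_eq]
    split_ifs with h
    · have : G.neighborSet a = Subtype.val '' H.neighborSet a := by
        ext w
        constructor
        · intro hw
          exact ⟨⟨w, hS w a hw.symm⟩, ⟨hw, h⟩, rfl⟩
        · rintro ⟨b, hb, rfl⟩
          exact hb.1
      rw [this, Subtype.val_injective.injOn.ncard_image]
    · have : H.neighborSet a = ∅ := by
        ext w
        exact ⟨fun hw => h hw.2, fun hw => hw.elim⟩
      rw [this, Set.ncard_empty]
  have hvS : v ∈ S := by
    obtain ⟨w, hw⟩ := Set.nonempty_of_ncard_ne_zero hv.pos.ne'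
    exact hS v w hw
  obtain ⟨w, hw, hodd⟩ := H.exists_ne_odd_degree_of_exists_odd_degree ⟨v, hvS⟩ (by
    rwa [hdeg, if_pos (SimpleGraph.Reachable.refl v)])
  rw [hdeg] at hodd
  split_ifs at hodd with h
  · exact ⟨w, fun hwv => hw (Subtype.ext hwv), h, hodd⟩
  · simp at hodd

theorem eq_innerVertex {N p : ℕ} {g : ℤ × ℤ} (hg : g ∈ grid N)
    (h : |(outerVertex N p).1 - g.1| + |(outerVertex N p).2 - g.2| = 1) : g = innerVertex N p := by
  obtain ⟨x, y⟩ := g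
  simp only [grid, Set.mem_ofPred_eq] at hg
  have h := abs_add_abs_eq_one h
  unfold outerVertex at h
  unfold innerVertex
  split_ifs at h ⊢ <;> simp only [Prod.mk.injEq] at h ⊢ <;> omega

theorem outerVertex_notMem {N p : ℕ} : outerVertex N p ∉ grid N := by
  unfold outerVertex grid
  split_ifs <;> simp only [Set.mem_ofPred_eq] <;> omega

theorem exists_eq_outerVertex {N : ℕ} {w g : ℤ × ℤ} (hg : g ∈ grid N) (hw : w ∉ grid N)
    (h : |w.1 - g.1| + |w.2 - g.2| = 1) : ∃ p < 4 * N, w = outerVertex N p := by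
  obtain ⟨x, y⟩ := g
  obtain ⟨a, b⟩ := w
  simp only [grid, Set.mem_ofPred_eq] at hg hw
  have h := abs_add_abs_eq_one h
  simp only at h
  by_cases h1 : a = 0
  · refine ⟨(N - b).toNat, by omega, ?_⟩
    rw [outerVertex, if_pos (by omega), Prod.mk.injEq]
    omega
  by_cases h2 : b = 0
  · refine ⟨(N + a - 1).toNat, by omega, ?_⟩
    rw [outerVertex, if_neg (by omega), if_pos (by omega), Prod.mk.injEq]
    omega
  by_cases h3 : a = N + 1
  · refine ⟨(2 * N + b - 1).toNat, by omega, ?_⟩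
    rw [outerVertex, if_neg (by omega), if_neg (by omega), if_pos (by omega), Prod.mk.injEq]
    omega
  · refine ⟨(4 * N - a).toNat, by omega, ?_⟩
    rw [outerVertex, if_neg (by omega), if_neg (by omega), if_neg (by omega), Prod.mk.injEq]
    omega

/-- Each endpoint is joined to another one. -/
theorem FPL.exists_reachable_endpoint {N : ℕ} (f : FPL N) (i : ℕ) (h1 : 1 ≤ i) (h2 : i ≤ 2 * N) :
    ∃ j, 1 ≤ j ∧ j ≤ 2 * N ∧ i ≠ j ∧ f.graph.Reachable (endpoint N i) (endpoint N j) := by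
  have hdeg : f.graph.neighborSet (endpoint N i) = {innerVertex N (2 * (i - 1))} := by
    ext g
    rw [SimpleGraph.mem_neighborSet, Set.mem_singleton_iff]
    constructor
    · intro h
      exact eq_innerVertex ((f.meets_grid _ _ h).resolve_left outerVertex_notMem)
        (f.lattice _ _ h)
    · rintro rfl
      exact (f.boundary _ (by omega)).2 (even_two_mul _)
  obtain ⟨w, hw, hr, ho⟩ := exists_reachable_odd f.graph
    (Finset.Icc (0 : ℤ) (N + 1) ×ˢ Finset.Icc (0 : ℤ) (N + 1)) (by
      rintro ⟨a, b⟩ ⟨c, d⟩ h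
      have e := abs_add_abs_eq_one (f.lattice _ _ h)
      have e' := f.meets_grid _ _ h
      simp only [grid, Set.mem_ofPred_eq] at e e'
      simp only [Finset.mem_product, Finset.mem_Icc]
      omega) (endpoint N i) (by rw [hdeg, Set.ncard_singleton]; exact odd_one)
  have hwg : w ∉ grid N := by
    intro hwg
    rw [f.degree_eq_two w hwg] at ho
    exact absurd ho (by decide)
  obtain ⟨g, hg⟩ := Set.nonempty_of_ncard_ne_zero ho.pos.ne'
  have hgg := (f.meets_grid _ _ hg).resolve_left hwg
  obtain ⟨p, hp, rfl⟩ := exists_eq_outerVertex hgg hwg (f.lattice _ _ hg)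
  have hgi := eq_innerVertex hgg (f.lattice _ _ hg)
  rw [SimpleGraph.mem_neighborSet, hgi, f.boundary p hp, even_iff_two_dvd] at hg
  obtain ⟨q, rfl⟩ := hg
  refine ⟨q + 1, by omega, by omega, ?_, ?_⟩
  · rintro rfl
    exact hw rfl
  · exact hr

/-- The invariant shows that every joined pair is allowed. Since each endpoint is joined to some
other one and has only one allowed partner, every allowed pair occurs. -/
theorem coupling_eq_puncturedRarest (hC : IsFrozenSum n C)
    (hG : Encodes (2 * n) 0 C f.graph) (hf : f.IsHalfTurnSymmetric) :
    ∃ k ≤ n, f.coupling = puncturedRarest k n := by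
  have hd := hC.diag_le 0 le_rfl (by omega)
  rw [hC.isCornerSum.left 0 le_rfl (by omega)] at hd
  have hd' := hC.le_antidiag 0 le_rfl (by omega)
  rw [hC.isCornerSum.left _ (by omega) (by omega)] at hd'
  obtain ⟨k, hk⟩ : ∃ k : ℕ, (k : ℤ) = n - C n n := ⟨(n - C n n).toNat, by omega⟩
  have hkn : k ≤ n := by omega
  refine ⟨k, hkn, Set.Subset.antisymm ?_ ?_⟩
  · rintro e ⟨i, j, h1, h2, h3, rfl, h⟩
    exact mem_puncturedRarest_of_reachable hC hG hf hk h1 (by omega) (by omega) (by omega)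
      (by omega) h
  · intro e
    induction e with | _ i j
    intro he
    have hij := (mem_puncturedRarest hkn).1 he
    obtain ⟨j', h1, h2, h3, h⟩ := f.exists_reachable_endpoint i (by omega) (by omega)
    have hm := (mem_puncturedRarest hkn).1 (mem_puncturedRarest_of_reachable hC hG hf hk (by omega)
      (by omega) h1 (by omega) h3 h)
    obtain rfl : j = j' := by omega
    rcases lt_or_gt_of_ne h3 with h4 | h4
    · exact ⟨i, j, by omega, h4, by omega, rfl, h⟩
    · exact ⟨j, i, by omega, h4, by omega, Sym2.eq_swap, h.symm⟩

/-! ### Punctured couplings freeze the triangles -/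

theorem not_reachable_of_isPuncturedVersion {n : ℕ} {f : FPL (2 * n)}
    (h : IsPuncturedVersion n (rarestCoupling n) f.coupling) {i j : ℕ} (h1 : 1 ≤ i)
    (h2 : i ≤ 4 * n) (h3 : 1 ≤ j) (h4 : j ≤ 4 * n) (hij : i ≠ j)
    (hs : (i ≤ n ∧ j ≤ n) ∨ (n < i ∧ i ≤ 2 * n ∧ n < j ∧ j ≤ 2 * n)) :
    ¬ f.graph.Reachable (endpoint (2 * n) i) (endpoint (2 * n) j) := by
  intro hr
  have hm : s(i, j) ∈ f.coupling := by
    rcases lt_or_gt_of_ne hij with h5 | h5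
    · exact ⟨i, j, h1, h5, by omega, rfl, hr⟩
    · exact ⟨j, i, h3, h5, by omega, Sym2.eq_swap, hr.symm⟩
  have := fold_add_eq h hm
  omega

theorem endpoint_left {n : ℕ} {y : ℤ} (h1 : 1 ≤ y) (h2 : y ≤ 2 * n) (h3 : y % 2 = 0) :
    endpoint (2 * n) (n + 1 - y / 2).toNat = (0, y) := by
  rw [endpoint, outerVertex, if_pos (by omega), Prod.mk.injEq]
  omega

theorem endpoint_bottom {n : ℕ} {x : ℤ} (h1 : 1 ≤ x) (h2 : x ≤ 2 * n) (h3 : x % 2 = 1) :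
    endpoint (2 * n) (n + 1 + x / 2).toNat = (x, 0) := by
  rw [endpoint, outerVertex, if_neg (by omega), if_pos (by omega), Prod.mk.injEq]
  omega

theorem FPL.isFrozenSum {n : ℕ} (f : FPL (2 * n)) (hf : f.IsHalfTurnSymmetric)
    (h : IsPuncturedVersion n (rarestCoupling n) f.coupling) : IsFrozenSum n f.cornerSum where
  isCornerSum := f.isCornerSum
  isHalfTurnSum := f.isHalfTurnSum_cornerSum hf
  left := by
    apply isFrozen_of_not_reachable f.isCornerSum f.encodes_cornerSum
    intro y y' h1 h2 h3 h4 h5 h6 h7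
    rw [← endpoint_left h1 h2 (by omega), ← endpoint_left h3 h4 (by omega)]
    exact not_reachable_of_isPuncturedVersion h (by omega) (by omega) (by omega) (by omega)
      (by omega) (by omega)
  bottom := by
    apply isFrozen_of_not_reachable f.isCornerSum.swap f.encodes_cornerSum.swap
    intro x x' h1 h2 h3 h4 h5 h6 h7 hr
    -- Undoes the transposition: the left border of the transposed graph is the bottom border.
    have hr := hr.map (SimpleGraph.Hom.comap Prod.swap f.graph)
    change f.graph.Reachable (x, 0) (x', 0) at hr
    rw [← endpoint_bottom h1 h2 (by omega), ← endpoint_bottom h3 h4 (by omega)] at hr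
    exact not_reachable_of_isPuncturedVersion h (by omega) (by omega) (by omega) (by omega)
      (by omega) (by omega) hr

theorem IsDiagonalHeight.isFrozenSum {n : ℤ} {h : ℤ → ℤ → ℤ} (hh : IsDiagonalHeight n h) :
    IsFrozenSum n (sumOfHeight n h) :=
  ⟨isCornerSum_sumOfHeight hh, isHalfTurnSum_sumOfHeight hh, isFrozen_sumOfHeight,
    isFrozen_sumOfHeight_swap⟩

/-! ### The bijection -/

/-- The half-turn symmetric configuration attached to a cyclically symmetric plane partition. -/
noncomputable def toHalfTurnFPL (n : ℕ)
    (P : {P : PlanePartition // P.IsCyclicallySymmetric ∧ P.FitsInBox n}) :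
    {f : FPL (2 * n) // f.IsHalfTurnSymmetric ∧
      IsPuncturedVersion n (rarestCoupling n) f.coupling} :=
  have hh := PlanePartition.isDiagonalHeight_height P.2.2 P.2.1
  have hC := isCornerSum_sumOfHeight hh
  have hf := FPL.isHalfTurnSymmetric_of_isHalfTurnSum hC.encodes_toFPL hC
    (isHalfTurnSum_sumOfHeight hh)
  ⟨hC.toFPL, hf, (isPuncturedVersion_rarestCoupling_iff n _).2
    (coupling_eq_puncturedRarest hh.isFrozenSum hC.encodes_toFPL hf)⟩

theorem encodes_toHalfTurnFPL (n : ℕ)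
    (P : {P : PlanePartition // P.IsCyclicallySymmetric ∧ P.FitsInBox n}) :
    Encodes (2 * n) 0 (sumOfHeight n (P.1.height n)) (toHalfTurnFPL n P).1.graph :=
  (isCornerSum_sumOfHeight
    (PlanePartition.isDiagonalHeight_height P.2.2 P.2.1)).encodes_toFPL

theorem toHalfTurnFPL_injective (n : ℕ) : Function.Injective (toHalfTurnFPL n) := by
  intro P Q hPQ
  have hP := encodes_toHalfTurnFPL n P
  rw [hPQ] at hP
  have := Encodes.unique
    (isCornerSum_sumOfHeight (PlanePartition.isDiagonalHeight_height P.2.2 P.2.1))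
    (isCornerSum_sumOfHeight (PlanePartition.isDiagonalHeight_height Q.2.2 Q.2.1))
    hP (encodes_toHalfTurnFPL n Q)
  exact Subtype.ext (PlanePartition.eq_of_height_eq P.2.2 P.2.1 Q.2.2 Q.2.1
    (height_eq_of_sumOfHeight_eq this))

/-- The preimage is built from the diagonal heights of the corner sum; the two graphs agree because
they encode the same function on the faces of the grid. -/
theorem toHalfTurnFPL_surjective (n : ℕ) : Function.Surjective (toHalfTurnFPL n) := by
  rintro ⟨f, hf, hp⟩
  have hC := f.isFrozenSum hf hp
  have hh := isDiagonalHeight_heightOfSum hC.isCornerSum hC.isHalfTurnSum hC.left hC.bottom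
  refine ⟨⟨hh.toPlanePartition, hh.isCyclicallySymmetric_toPlanePartition,
    hh.fitsInBox_toPlanePartition⟩, Subtype.ext ?_⟩
  have h1 := encodes_toHalfTurnFPL n ⟨hh.toPlanePartition,
    hh.isCyclicallySymmetric_toPlanePartition, hh.fitsInBox_toPlanePartition⟩
  refine FPL.eq_of_encodes (p := 0) (C := f.cornerSum) (h1.congr ?_) f.encodes_cornerSum
  intro x y h2 h3 h4 h5
  rw [← sumOfHeight_heightOfSum hC.isHalfTurnSum hC.left hC.bottom x y h2 h3 h4 h5]
  exact sumOfHeight_congr (fun a b h6 h7 h8 h9 =>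
    hh.height_toPlanePartition a b h6 h7 h8 h9) x y h2 h3 h4 h5

end FPLoop

theorem mainTheorem1 (n : ℕ) :
    (∀ c : Set (Sym2 ℕ),
      FPLoop.IsPuncturedVersion n (FPLoop.rarestCoupling n) c ↔
        ∃ k ≤ n, c = FPLoop.puncturedRarest k n) ∧
    {c : Set (Sym2 ℕ) | FPLoop.IsPuncturedVersion n (FPLoop.rarestCoupling n) c}.ncard = n + 1 ∧
    Nonempty
      ({f : FPLoop.FPL (2 * n) // f.IsHalfTurnSymmetric ∧
          FPLoop.IsPuncturedVersion n (FPLoop.rarestCoupling n) f.coupling} ≃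
        {P : FPLoop.PlanePartition // P.IsCyclicallySymmetric ∧ P.FitsInBox n}) :=
  ⟨FPLoop.isPuncturedVersion_rarestCoupling_iff n, FPLoop.ncard_isPuncturedVersion n,
    ⟨(Equiv.ofBijective (FPLoop.toHalfTurnFPL n)
      ⟨FPLoop.toHalfTurnFPL_injective n, FPLoop.toHalfTurnFPL_surjective n⟩).symm⟩⟩
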